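/- Let $\mathcal A$ be a unital $C^*$-algebra and $\varphi$ a state on $\mathcal A$ (a linear functional with $\varphi(a^*a)\ge 0$ for all $a$ and $\varphi(1)=1$); write $M_k(X)=\varphi(X^k)$. Self-adjoint elements $(x_i)_{i\in I}$ of a unital $*$-algebra with a state $\varphi$, indexed by a linearly ordered set $I$, are called monotone independent if, with $\mathcal A_i$ the (non-unital) $*$-algebra generated by $x_i$, one has $$\varphi(a_1\cdots a_j\cdots a_n)=\varphi(a_j)\,\varphi(a_1\cdots a_{j-1}a_{j+1}\cdots a_n)$$ whenever $n \geq 2$, $a_m\in\mathcal A_{i_m}$, $a_m\notin\mathbb C1$, $i_m\ne i_{m+1}$, and $i_{j-1}<i_j>i_{j+1}$ (one inequality being dropped if $j=1$ or $j=n$). A distribution of a self-adjoint $X$ is a probability measure $\mu$ on $\mathbb R$ with all moments finite and $\int x^k\,\mu(dx)=M_k(X)$ for all $k\ge0$. The monotone cumulants $r_n(\mu)$, $n\ge1$, of a probability measure $\mu$ on $\mathbb R$ with all moments finite are defined as follows: for each $N$ let $Y_1,\dots,Y_N$ be monotone independent self-adjoint elements of some unital $*$-algebra with a state, each with distribution $\mu$;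 the $n$-th moment of $Y_1+\cdots+Y_N$ is a polynomial in $N$, and $r_n(\mu)$ is its coefficient of $N$. Let $\lambda>0$ and let $X_N^{(n)}\in\mathcal A$ $(1\le n\le N,\ 1\le N<\infty)$ be self-adjoint elements such that (1) for each $N$, the elements $X_N^{(1)},\dots,X_N^{(N)}$ are monotone independent and identically distributed, i.e. $M_k(X_N^{(n)})=M_k(X_N^{(1)})$ for all $k$ and all $1\le n\le N$; (2) $N\,M_k(X_N^{(1)})\to\lambda$ as $N\to\infty$ for every $k\ge1$. Then each sum $X_N:=X_N^{(1)}+\cdots+X_N^{(N)}$ has a unique distribution $\mu_N$; there is exactly one probability measure $\nu$ on $\mathbb R$ whose monotone cumulants are all equal to $\lambda$ (the monotone Poisson distribution with parameter $\lambda$); and $\mu_N$ converges weakly to $\nu$ as $N\to\infty$. -/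

import Mathlib

open scoped ComplexOrder
open MeasureTheory Filter Topology

/-- A state on a unital `*`-algebra over `ℂ`. -/
structure IsState {A : Type*} [Ring A] [StarRing A] [Algebra ℂ A] (φ : A →ₗ[ℂ] ℂ) : Prop where
  nonneg : ∀ a : A, 0 ≤ φ (star a * a)
  map_one : φ 1 = 1

/-- Monotone independence of a family of (not necessarily unital) `*`-subalgebras `S i`, indexed by
a linearly ordered set. A word `a₁ ⋯ aₙ` with `aₖ ∈ S (iₖ)` is the list of the pairs `(iₖ, aₖ)`.
If no `aₖ` is a scalar and neighbouring indices differ, then a letter `a` whose index is larger than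
the indices of its (at most two) neighbours factors out:
`φ (a₁ ⋯ a ⋯ aₙ) = φ a * φ (a₁ ⋯ aₙ with a removed)`. -/
def MonotoneIndepAlg {A ι : Type*} [Ring A] [StarRing A] [Algebra ℂ A] [LinearOrder ι]
    (φ : A →ₗ[ℂ] ℂ) (S : ι → NonUnitalStarSubalgebra ℂ A) : Prop :=
  ∀ (u v : List (ι × A)) (i : ι) (a : A),
    (∀ p ∈ u ++ (i, a) :: v, p.2 ∈ S p.1 ∧ p.2 ∉ Set.range (algebraMap ℂ A)) →
    ((u ++ (i, a) :: v).map Prod.fst).IsChain (· ≠ ·) →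
    (∀ p ∈ u.getLast?, p.1 < i) →
    (∀ p ∈ v.head?, p.1 < i) →
    φ ((u ++ (i, a) :: v).map Prod.snd).prod = φ a * φ ((u ++ v).map Prod.snd).prod

/-- Monotone independence of random variables: the non-unital `*`-algebras that they generate are
monotone independent. (With unital algebras the notion would degenerate: inserting `1` of a lower
algebra between elements `b, c` of a higher one would force `φ (b * c) = φ b * φ c`.) -/
def MonotoneIndep {A ι : Type*} [Ring A] [StarRing A] [Algebra ℂ A] [StarModule ℂ A]
    [LinearOrder ι] (φ : A →ₗ[ℂ] ℂ) (X : ι → A) : Prop :=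
  MonotoneIndepAlg φ fun i => NonUnitalStarAlgebra.adjoin ℂ {X i}

/-- `μ` is a distribution of the random variable `a`: all its moments exist and are those of `a`. -/
def HasDistribution {A : Type*} [Ring A] [Algebra ℂ A]
    (φ : A →ₗ[ℂ] ℂ) (a : A) (μ : ProbabilityMeasure ℝ) : Prop :=
  ∀ k : ℕ, Integrable (fun x : ℝ => x ^ k) (μ : Measure ℝ) ∧
    φ (a ^ k) = ((∫ x : ℝ, x ^ k ∂(μ : Measure ℝ) : ℝ) : ℂ)

/-- `r n` (`n ≥ 1`) are the monotone cumulants of the law `μ`: for monotone independent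
self-adjoint random variables `Y₁, …, Y_N` with law `μ` in an algebraic probability space,
the `n`-th moment of `Y₁ + ⋯ + Y_N` is a polynomial in `N`, and `r n` is its coefficient of `N`. -/
def HasMonotoneCumulants (μ : ProbabilityMeasure ℝ) (r : ℕ → ℝ) : Prop :=
  ∃ p : ℕ → Polynomial ℝ, (∀ n : ℕ, 1 ≤ n → (p n).coeff 1 = r n) ∧
    ∀ N : ℕ, ∃ (B : Type) (_ : Ring B) (_ : StarRing B) (_ : Algebra ℂ B) (_ : StarModule ℂ B)
      (ψ : B →ₗ[ℂ] ℂ) (Y : Fin N → B),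
      IsState ψ ∧ (∀ i, IsSelfAdjoint (Y i)) ∧ (∀ i, HasDistribution ψ (Y i) μ) ∧
      MonotoneIndep ψ Y ∧
      ∀ n : ℕ, 1 ≤ n → ψ ((∑ i, Y i) ^ n) = (((p n).eval (N : ℝ) : ℝ) : ℂ)

/-- `μ` is a monotone Poisson distribution with parameter `l`: its monotone cumulants all equal
`l`. -/
def IsMonotonePoisson (l : ℝ) (μ : ProbabilityMeasure ℝ) : Prop :=
  HasMonotoneCumulants μ fun _ => l

/-!
If `x` lies above the monotone independent elements that make up `T`, then the moment series of
`T + x` is obtained from those of `T` and `x` by composing `w * M(w)`: this is the composition of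
reciprocal Cauchy transforms. On power series modulo `w ^ (d + 1)` composition is multiplication of
unipotent matrices, so the moments of the `N`-th row sum are the first row of `(1 + S_N) ^ N`, and
`N * M_k → r k` says that `N • S_N` tends to the nilpotent matrix `G` of the vector field
`∑ k, r k * w ^ (k + 1) * d/dw`. Hence the moments converge to the first row of `exp G`. They grow
at most geometrically, so they determine their law, and the row sums converge weakly to it.

Since `exp (N • G)` is a polynomial in `N` with linear coefficient `G`, a law with these moments has
cumulants `r`, once independent copies are realised: on `L²(ν; H)` multiplication by the coordinate
is monotone independent of the operators on `H`, embedded along the constants. Conversely, if the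
moments of `N`-fold sums are polynomials in `N`, substituting the time `1 / N` gives an `N`-th root
of the law under monotone convolution, and the limit along these roots recovers `exp G`.

The factorization rule says nothing about words with scalar letters. These can be removed as long
as the algebras of all lower variables are non-unital: if `1` were in a lower algebra, the state
would be multiplicative on the higher ones, and their variances would vanish.
-/

/-! ### Monotone convolution of moment series -/

section MonotoneConvolution

open PowerSeries Finset

variable {R : Type*} [CommRing R]

/-- The monotone convolution of two moment series, i.e. the moment series of `T + x` when the
variable `x` lies above `T`. Reciprocal Cauchy transforms compose under monotone convolution; in
terms of the moment series this reads `X * (S ▷ M) = (X * S) ∘ (X * M)`. -/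
noncomputable def monotoneConv (S M : R⟦X⟧) : R⟦X⟧ :=
  PowerSeries.mk fun n => ∑ m ∈ range (n + 1), coeff m S * coeff n (X ^ m * M ^ (m + 1))

/-- The monotone convolution powers of a moment series. -/
noncomputable def monotonePow (M : R⟦X⟧) : ℕ → R⟦X⟧
  | 0 => 1
  | N + 1 => monotoneConv (monotonePow M N) M

/-- The matrix of the composition operator `f ↦ f ∘ (X * M)` on power series without constant term,
in the basis `X ^ (j + 1)`, truncated to the first `d` basis elements. It turns monotone convolution
into multiplication of unipotent matrices. -/
noncomputable def compMatrix (d : ℕ) (M : R⟦X⟧) : Matrix (Fin d) (Fin d) R :=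
  Matrix.of fun j n => coeff (n : ℕ) (X ^ (j : ℕ) * M ^ ((j : ℕ) + 1))

lemma hasSubst_X_mul (M : R⟦X⟧) : HasSubst (X * M) :=
  HasSubst.of_constantCoeff_zero' (by simp)

lemma coeff_succ_subst_X_mul (F M : R⟦X⟧) {n d : ℕ} (h : n < d) :
    coeff (n + 1) ((X * F).subst (X * M)) =
      ∑ m ∈ range d, coeff m F * coeff n (X ^ m * M ^ (m + 1)) := by
  have hsupp : (Function.support fun m => coeff m (X * F) • coeff (n + 1) ((X * M) ^ m)) ⊆
      (range (d + 1) : Set ℕ) := by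
    intro m hm
    by_contra hmd
    rw [coe_range, Set.mem_Iio, not_lt] at hmd
    exact hm (by simp only [mul_pow, coeff_X_pow_mul', if_neg (show ¬ m ≤ n + 1 by omega),
      smul_zero])
  rw [coeff_subst' (hasSubst_X_mul M), finsum_eq_sum_of_support_subset _ hsupp, sum_range_succ']
  simp only [coeff_succ_X_mul, smul_eq_mul, pow_zero, coeff_zero_X_mul, zero_mul, add_zero]
  refine sum_congr rfl fun m _ => ?_
  rw [← coeff_succ_X_mul n (X ^ m * M ^ (m + 1)), mul_pow, pow_succ' X m, mul_assoc]

lemma X_mul_monotoneConv (S M : R⟦X⟧) : X * monotoneConv S M = (X * S).subst (X * M) := by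
  ext (_ | n)
  · rw [coeff_zero_X_mul, coeff_zero_eq_constantCoeff]
    exact (constantCoeff_subst_eq_zero (a := X * M)
      (show PowerSeries.constantCoeff (X * M) = 0 by simp) (X * S) (by simp)).symm
  · rw [coeff_succ_X_mul, coeff_succ_subst_X_mul S M n.lt_succ_self, monotoneConv, coeff_mk]

lemma compMatrix_monotoneConv (d : ℕ) (S M : R⟦X⟧) :
    compMatrix d (monotoneConv S M) = compMatrix d S * compMatrix d M := by
  ext j n
  have hsubst : X * (X ^ (j : ℕ) * monotoneConv S M ^ ((j : ℕ) + 1)) =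
      (X * (X ^ (j : ℕ) * S ^ ((j : ℕ) + 1))).subst (X * M) := by
    calc _ = (X * monotoneConv S M) ^ ((j : ℕ) + 1) := by ring
      _ = ((X * S) ^ ((j : ℕ) + 1)).subst (X * M) := by
        rw [X_mul_monotoneConv, subst_pow (hasSubst_X_mul M)]
      _ = _ := by congr 1; ring
  rw [Matrix.mul_apply]
  simp only [compMatrix, Matrix.of_apply]
  rw [← coeff_succ_X_mul, hsubst, coeff_succ_subst_X_mul _ _ n.2, Finset.sum_range]

lemma compMatrix_one (d : ℕ) : compMatrix d (1 : R⟦X⟧) = 1 := by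
  ext j n
  simp [compMatrix, Matrix.one_apply, coeff_X_pow, Fin.ext_iff, eq_comm]

lemma compMatrix_monotonePow (d : ℕ) (M : R⟦X⟧) (N : ℕ) :
    compMatrix d (monotonePow M N) = compMatrix d M ^ N := by
  induction N with
  | zero => rw [monotonePow, compMatrix_one, pow_zero]
  | succ N ih => rw [monotonePow, compMatrix_monotoneConv, ih, pow_succ]

lemma compMatrix_zero_last (M : R⟦X⟧) (n : ℕ) :
    compMatrix (n + 1) M 0 (Fin.last n) = coeff n M := by
  simp [compMatrix]

lemma monotonePow_mul (M : R⟦X⟧) (a b : ℕ) :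
    monotonePow M (a * b) = monotonePow (monotonePow M a) b := by
  ext n
  simp only [← compMatrix_zero_last, compMatrix_monotonePow, pow_mul]

lemma monotonePow_one (M : R⟦X⟧) : monotonePow M 1 = M := by
  ext n
  rw [← compMatrix_zero_last, compMatrix_monotonePow, pow_one, compMatrix_zero_last]

lemma constantCoeff_monotonePow {M : R⟦X⟧} (hM : constantCoeff M = 1) (N : ℕ) :
    constantCoeff (monotonePow M N) = 1 := by
  induction N with
  | zero => rw [monotonePow, map_one]
  | succ N ih =>
    rw [← coeff_zero_eq_constantCoeff_apply] at ih ⊢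
    simp [monotonePow, monotoneConv, ih, hM]

lemma map_monotoneConv {R' : Type*} [CommRing R'] (f : R →+* R') (S M : R⟦X⟧) :
    PowerSeries.map f (monotoneConv S M) =
      monotoneConv (PowerSeries.map f S) (PowerSeries.map f M) := by
  ext n
  simp only [monotoneConv, coeff_map, coeff_mk, map_sum, map_mul, ← map_pow]
  simp only [← PowerSeries.map_X f, ← map_pow, ← map_mul, coeff_map]

lemma map_monotonePow {R' : Type*} [CommRing R'] (f : R →+* R') (M : R⟦X⟧) (N : ℕ) :
    PowerSeries.map f (monotonePow M N) = monotonePow (PowerSeries.map f M) N := by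
  induction N with
  | zero => exact map_one _
  | succ N ih => rw [monotonePow, map_monotoneConv, ih, monotonePow]

end MonotoneConvolution

/-! ### From cumulants to moments -/

section NilpotentExponential

/-- A matrix whose nonzero entries lie strictly above the diagonal. -/
def IsStrictlyUpperTriangular {R : Type*} [Zero R] {d : ℕ} (S : Matrix (Fin d) (Fin d) R) : Prop :=
  ∀ j n, n ≤ j → S j n = 0

lemma IsStrictlyUpperTriangular.pow_apply_eq_zero {R : Type*} [Semiring R] {d : ℕ}
    {S : Matrix (Fin d) (Fin d) R} (hS : IsStrictlyUpperTriangular S) (k : ℕ) {j n : Fin d}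
    (h : (n : ℕ) < j + k) : (S ^ k) j n = 0 := by
  induction k generalizing n with
  | zero => rw [pow_zero, Matrix.one_apply_ne (by rintro rfl; omega)]
  | succ k ih =>
    rw [pow_succ, Matrix.mul_apply]
    refine Finset.sum_eq_zero fun m _ => ?_
    by_cases hm : n ≤ m
    · rw [hS m n hm, mul_zero]
    · rw [ih (by rw [not_le, Fin.lt_def] at hm; omega), zero_mul]

lemma IsStrictlyUpperTriangular.pow_eq_zero {R : Type*} [Semiring R] {d : ℕ}
    {S : Matrix (Fin d) (Fin d) R} (hS : IsStrictlyUpperTriangular S) : S ^ d = 0 := by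
  ext j n
  exact hS.pow_apply_eq_zero d (by omega)

lemma isNilpotent_exp_nsmul {A : Type*} [Ring A] [Module ℚ A] {a : A} (h : IsNilpotent a)
    (N : ℕ) : IsNilpotent.exp (N • a) = IsNilpotent.exp a ^ N := by
  induction N with
  | zero => rw [zero_smul, IsNilpotent.exp_zero, pow_zero]
  | succ N ih =>
    rw [succ_nsmul, IsNilpotent.exp_add_of_commute ((Commute.refl a).smul_left N) (h.smul N) h, ih,
      pow_succ]

lemma isNilpotent_exp_eq_sum_inv_factorial_smul (𝕜 : Type*) {A : Type*} [Field 𝕜] [CharZero 𝕜]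
    [Ring A] [Module 𝕜 A] [Module ℚ A] {a : A} {d : ℕ} (h : a ^ d = 0) :
    IsNilpotent.exp a = ∑ k ∈ Finset.range d, (k.factorial : 𝕜)⁻¹ • a ^ k := by
  rw [IsNilpotent.exp_eq_sum h]
  refine Finset.sum_congr rfl fun k _ => ?_
  rw [← Rat.cast_smul_eq_qsmul 𝕜, Rat.cast_inv, Rat.cast_natCast]

lemma tendsto_choose_div_pow (k : ℕ) :
    Tendsto (fun N : ℕ => (N.choose k : ℝ) / (N : ℝ) ^ k) atTop (𝓝 (k.factorial : ℝ)⁻¹) := by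
  have h : Tendsto (fun N : ℕ => (N : ℝ) * (N : ℝ)⁻¹) atTop (𝓝 1) := by
    refine tendsto_const_nhds.congr' ?_
    filter_upwards [eventually_ne_atTop 0] with N hN
    rw [mul_inv_cancel₀ (Nat.cast_ne_zero.2 hN)]
  simpa only [div_eq_mul_inv, inv_pow, one_pow, one_mul] using
    ProbabilityTheory.tendsto_choose_mul_pow_atTop k h

lemma one_add_pow_eq_sum_range_of_pow_eq_zero {A : Type*} [Ring A] {S : A} {d N : ℕ}
    (hS : S ^ d = 0) (hN : d ≤ N) :
    (1 + S) ^ N = ∑ k ∈ Finset.range d, N.choose k • S ^ k := by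
  rw [add_comm, (Commute.one_right S).add_pow, ← Finset.sum_subset (Finset.range_subset_range.2
    (show d ≤ N + 1 by omega))]
  · refine Finset.sum_congr rfl fun k _ => ?_
    rw [one_pow, mul_one, nsmul_eq_mul, (Nat.cast_commute _ _).eq]
  · intro k _ hk
    rw [pow_eq_zero_of_le (by simpa using hk) hS, zero_mul, zero_mul]

lemma tendsto_one_add_pow_of_pow_eq_zero {A : Type*} [Ring A] [Module ℚ A] [Algebra ℝ A]
    [TopologicalSpace A] [IsTopologicalRing A] [ContinuousSMul ℝ A] [T2Space A] {S : ℕ → A} {L : A}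
    {d : ℕ} (hS : ∀ᶠ N in atTop, S N ^ d = 0)
    (hL : Tendsto (fun N : ℕ => (N : ℝ) • S N) atTop (𝓝 L)) :
    Tendsto (fun N => (1 + S N) ^ N) atTop (𝓝 (IsNilpotent.exp L)) := by
  have hLd : L ^ d = 0 := by
    refine tendsto_nhds_unique (hL.pow d) (tendsto_const_nhds.congr' ?_)
    filter_upwards [hS] with N h
    rw [smul_pow, h, smul_zero]
  rw [isNilpotent_exp_eq_sum_inv_factorial_smul ℝ hLd]
  have hsum : Tendsto (fun N : ℕ => ∑ k ∈ Finset.range d,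
      ((N.choose k : ℝ) / (N : ℝ) ^ k) • ((N : ℝ) • S N) ^ k) atTop
      (𝓝 (∑ k ∈ Finset.range d, (k.factorial : ℝ)⁻¹ • L ^ k)) :=
    tendsto_finsetSum _ fun k _ => (tendsto_choose_div_pow k).smul (hL.pow k)
  refine hsum.congr' ?_
  filter_upwards [hS, eventually_ge_atTop d, eventually_gt_atTop 0] with N h hd hN
  rw [one_add_pow_eq_sum_range_of_pow_eq_zero h hd]
  refine Finset.sum_congr rfl fun k _ => ?_
  rw [smul_pow, smul_smul, div_mul_cancel₀ _ (by positivity), Nat.cast_smul_eq_nsmul]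

end NilpotentExponential

section CumulantsToMoments

open PowerSeries Finset
open scoped PowerSeries.WithPiTopology

/-- The power series `∑ k ≥ 1, r k * X ^ k`. -/
noncomputable def cumulantSeries (r : ℕ → ℝ) : ℝ⟦X⟧ :=
  PowerSeries.mk fun k => if k = 0 then 0 else r k

/-- The infinitesimal generator of the semigroup of composition matrices with monotone cumulants
`r`: the truncated matrix of the vector field `∑ k, r k * w ^ (k + 1) * d/dw` in the basis
`w ^ (j + 1)`. -/
def cumulantGenerator (d : ℕ) (r : ℕ → ℝ) : Matrix (Fin d) (Fin d) ℝ :=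
  Matrix.of fun j n => if (j : ℕ) < n then ((j : ℕ) + 1) * r (n - j) else 0

/-- The moment series with monotone cumulants `r`: the first row of the exponential of the
generator. -/
noncomputable def cumulantMomentSeries (r : ℕ → ℝ) : ℝ⟦X⟧ :=
  PowerSeries.mk fun n => IsNilpotent.exp (cumulantGenerator (n + 1) r) 0 (Fin.last n)

/-- The `n`-th moment of the `N`-fold monotone convolution power of a law with monotone cumulants
`r`, as a polynomial in `N`. -/
noncomputable def cumulantMomentPolynomial (r : ℕ → ℝ) (n : ℕ) : Polynomial ℝ :=
  ∑ k ∈ range (n + 1), Polynomial.C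
    ((k.factorial : ℝ)⁻¹ * (cumulantGenerator (n + 1) r ^ k) 0 (Fin.last n)) * Polynomial.X ^ k

variable {r : ℕ → ℝ}

lemma isStrictlyUpperTriangular_cumulantGenerator (d : ℕ) (r : ℕ → ℝ) :
    IsStrictlyUpperTriangular (cumulantGenerator d r) := fun _ _ h => by
  simp [cumulantGenerator, not_lt.2 h]

lemma isStrictlyUpperTriangular_compMatrix_sub_one (d : ℕ) {M : ℝ⟦X⟧}
    (hM : constantCoeff M = 1) : IsStrictlyUpperTriangular (compMatrix d M - 1) := by
  intro j n h
  rw [Matrix.sub_apply, compMatrix, Matrix.of_apply, coeff_X_pow_mul']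
  rcases h.eq_or_lt with rfl | h
  · simp [hM]
  · rw [if_neg (by rw [Fin.lt_def] at h; omega), Matrix.one_apply_ne h.ne', sub_zero]

lemma coeff_natCast_mul (N k : ℕ) (f : ℝ⟦X⟧) :
    coeff k ((N : ℝ⟦X⟧) * f) = (N : ℝ) * coeff k f := by
  rw [← map_natCast (C (R := ℝ)) N, coeff_C_mul]

lemma tendsto_natCast_mul_pow_sub_one {M : ℕ → ℝ⟦X⟧} {V : ℝ⟦X⟧}
    (h : Tendsto (fun N : ℕ => (N : ℝ⟦X⟧) * (M N - 1)) atTop (𝓝 V))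
    (h1 : Tendsto M atTop (𝓝 1)) (j : ℕ) :
    Tendsto (fun N : ℕ => (N : ℝ⟦X⟧) * (M N ^ j - 1)) atTop (𝓝 (j * V)) := by
  induction j with
  | zero => simp
  | succ j ih =>
    have hsucc := (ih.mul h1).add h
    rw [mul_one, ← add_one_mul] at hsucc
    rw [Nat.cast_succ]
    exact hsucc.congr fun N => by ring

lemma tendsto_one_of_tendsto_natCast_mul_sub_one {M : ℕ → ℝ⟦X⟧} {V : ℝ⟦X⟧}
    (h : Tendsto (fun N : ℕ => (N : ℝ⟦X⟧) * (M N - 1)) atTop (𝓝 V)) :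
    Tendsto M atTop (𝓝 1) := by
  rw [WithPiTopology.tendsto_iff_coeff_tendsto] at h ⊢
  intro k
  have hmul := (tendsto_inv_atTop_nhds_zero_nat (𝕜 := ℝ)).mul (h k)
  have hadd := hmul.add_const (coeff k (1 : ℝ⟦X⟧))
  rw [zero_mul, zero_add] at hadd
  refine hadd.congr' ?_
  filter_upwards [eventually_ne_atTop 0] with N hN
  rw [coeff_natCast_mul, inv_mul_cancel_left₀ (Nat.cast_ne_zero.2 hN), map_sub, sub_add_cancel]

lemma tendsto_natCast_mul_sub_one {M : ℕ → ℝ⟦X⟧} (h0 : ∀ᶠ N in atTop, constantCoeff (M N) = 1)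
    (h : ∀ k, 1 ≤ k → Tendsto (fun N : ℕ => (N : ℝ) * coeff k (M N)) atTop (𝓝 (r k))) :
    Tendsto (fun N : ℕ => (N : ℝ⟦X⟧) * (M N - 1)) atTop (𝓝 (cumulantSeries r)) := by
  rw [WithPiTopology.tendsto_iff_coeff_tendsto]
  intro k
  simp only [coeff_natCast_mul, cumulantSeries, coeff_mk]
  split_ifs with hk
  · subst hk
    refine tendsto_const_nhds.congr' ?_
    filter_upwards [h0] with N hN
    simp [hN]
  · refine (h k (Nat.one_le_iff_ne_zero.2 hk)).congr fun N => ?_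
    rw [map_sub, coeff_one, if_neg hk, sub_zero]

lemma tendsto_smul_compMatrix_sub_one {M : ℕ → ℝ⟦X⟧}
    (h : Tendsto (fun N : ℕ => (N : ℝ⟦X⟧) * (M N - 1)) atTop (𝓝 (cumulantSeries r))) (d : ℕ) :
    Tendsto (fun N : ℕ => (N : ℝ) • (compMatrix d (M N) - 1)) atTop
      (𝓝 (cumulantGenerator d r)) := by
  refine tendsto_pi_nhds.2 fun j => tendsto_pi_nhds.2 fun n => ?_
  have hpow := tendsto_natCast_mul_pow_sub_one h (tendsto_one_of_tendsto_natCast_mul_sub_one h)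
    ((j : ℕ) + 1)
  convert (WithPiTopology.tendsto_iff_coeff_tendsto _ _ _ _).1
    (hpow.const_mul ((X : ℝ⟦X⟧) ^ (j : ℕ))) n using 1
  · ext N
    rw [mul_left_comm, coeff_natCast_mul, mul_sub, map_sub, mul_one, coeff_X_pow]
    simp [compMatrix, Matrix.one_apply, Fin.ext_iff, eq_comm]
  · rw [mul_left_comm, coeff_natCast_mul, coeff_X_pow_mul', cumulantSeries, coeff_mk,
      cumulantGenerator, Matrix.of_apply, Nat.cast_succ]
    congr 1
    rcases lt_trichotomy (j : ℕ) n with hjn | hjn | hjn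
    · rw [if_pos hjn, if_pos hjn.le, if_neg (by omega)]
    · rw [if_neg (by omega), if_pos hjn.le, if_pos (by omega), mul_zero]
    · rw [if_neg (by omega), if_neg (by omega), mul_zero]

lemma tendsto_compMatrix_pow {M : ℕ → ℝ⟦X⟧} (h0 : ∀ᶠ N in atTop, constantCoeff (M N) = 1)
    (h : ∀ k, 1 ≤ k → Tendsto (fun N : ℕ => (N : ℝ) * coeff k (M N)) atTop (𝓝 (r k))) (d : ℕ) :
    Tendsto (fun N : ℕ => compMatrix d (M N) ^ N) atTop
      (𝓝 (IsNilpotent.exp (cumulantGenerator d r))) := by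
  have hexp := tendsto_one_add_pow_of_pow_eq_zero
    (h0.mono fun N hN => (isStrictlyUpperTriangular_compMatrix_sub_one d hN).pow_eq_zero)
    (tendsto_smul_compMatrix_sub_one (tendsto_natCast_mul_sub_one h0 h) d)
  simpa only [add_sub_cancel] using hexp

lemma tendsto_coeff_monotonePow {M : ℕ → ℝ⟦X⟧} (h0 : ∀ᶠ N in atTop, constantCoeff (M N) = 1)
    (h : ∀ k, 1 ≤ k → Tendsto (fun N : ℕ => (N : ℝ) * coeff k (M N)) atTop (𝓝 (r k))) (n : ℕ) :
    Tendsto (fun N : ℕ => coeff n (monotonePow (M N) N)) atTop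
      (𝓝 (coeff n (cumulantMomentSeries r))) := by
  simp only [← compMatrix_zero_last, compMatrix_monotonePow]
  rw [compMatrix_zero_last, cumulantMomentSeries, coeff_mk]
  exact tendsto_pi_nhds.1 (tendsto_pi_nhds.1 (tendsto_compMatrix_pow h0 h (n + 1)) 0) (Fin.last n)

lemma compMatrix_cumulantMomentSeries (d : ℕ) (r : ℕ → ℝ) :
    compMatrix d (cumulantMomentSeries r) = IsNilpotent.exp (cumulantGenerator d r) := by
  let M : ℕ → ℝ⟦X⟧ := fun N => PowerSeries.mk fun k => if k = 0 then 1 else r k / N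
  have h0 : ∀ᶠ N in atTop, constantCoeff (M N) = 1 := Eventually.of_forall fun N => by
    rw [← coeff_zero_eq_constantCoeff_apply, coeff_mk, if_pos rfl]
  have h : ∀ k, 1 ≤ k → Tendsto (fun N : ℕ => (N : ℝ) * coeff k (M N)) atTop (𝓝 (r k)) := by
    intro k hk
    refine tendsto_const_nhds.congr' ?_
    filter_upwards [eventually_ne_atTop 0] with N hN
    rw [coeff_mk, if_neg (by omega), mul_div_cancel₀ _ (Nat.cast_ne_zero.2 hN)]
  have hS : Tendsto (fun N => monotonePow (M N) N) atTop (𝓝 (cumulantMomentSeries r)) :=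
    (WithPiTopology.tendsto_iff_coeff_tendsto _ _ _ _).2 (tendsto_coeff_monotonePow h0 h)
  have hT : Tendsto (fun N => compMatrix d (monotonePow (M N) N)) atTop
      (𝓝 (compMatrix d (cumulantMomentSeries r))) :=
    tendsto_pi_nhds.2 fun j => tendsto_pi_nhds.2 fun n =>
      (WithPiTopology.tendsto_iff_coeff_tendsto _ _ _ _).1
        ((hS.pow ((j : ℕ) + 1)).const_mul (X ^ (j : ℕ))) n
  simp only [compMatrix_monotonePow] at hT
  exact tendsto_nhds_unique hT (tendsto_compMatrix_pow h0 h d)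

lemma coeff_cumulantMomentSeries (r : ℕ → ℝ) (n : ℕ) :
    coeff n (cumulantMomentSeries r) = ∑ k ∈ range (n + 1),
      (k.factorial : ℝ)⁻¹ * (cumulantGenerator (n + 1) r ^ k) 0 (Fin.last n) := by
  rw [cumulantMomentSeries, coeff_mk, isNilpotent_exp_eq_sum_inv_factorial_smul ℝ
    (isStrictlyUpperTriangular_cumulantGenerator (n + 1) r).pow_eq_zero, Matrix.sum_apply]
  simp only [Matrix.smul_apply, smul_eq_mul]

lemma eval_cumulantMomentPolynomial (r : ℕ → ℝ) (n N : ℕ) :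
    (cumulantMomentPolynomial r n).eval (N : ℝ) =
      coeff n (monotonePow (cumulantMomentSeries r) N) := by
  have hG := (isStrictlyUpperTriangular_cumulantGenerator (n + 1) r).pow_eq_zero
  rw [← compMatrix_zero_last, compMatrix_monotonePow, compMatrix_cumulantMomentSeries,
    ← isNilpotent_exp_nsmul ⟨_, hG⟩,
    isNilpotent_exp_eq_sum_inv_factorial_smul ℝ (d := n + 1) (by rw [smul_pow, hG, smul_zero]),
    Matrix.sum_apply, cumulantMomentPolynomial, Polynomial.eval_finsetSum]
  refine sum_congr rfl fun k _ => ?_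
  rw [smul_pow, Matrix.smul_apply, Matrix.smul_apply, smul_eq_mul, nsmul_eq_mul]
  simp only [Polynomial.eval_mul, Polynomial.eval_C, Polynomial.eval_pow, Polynomial.eval_X,
    Nat.cast_pow]
  ring

lemma coeff_one_cumulantMomentPolynomial (r : ℕ → ℝ) {n : ℕ} (hn : 1 ≤ n) :
    (cumulantMomentPolynomial r n).coeff 1 = r n := by
  simp only [cumulantMomentPolynomial, Polynomial.finsetSum_coeff, Polynomial.coeff_C_mul,
    Polynomial.coeff_X_pow]
  rw [sum_eq_single_of_mem 1 (mem_range.2 (by omega))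
    fun k _ hk => by rw [if_neg hk.symm, mul_zero]]
  simp [cumulantGenerator, Nat.one_le_iff_ne_zero.1 hn]

lemma sum_range_choose_const (n k : ℕ) : ∑ m ∈ range n, m.choose k = n.choose (k + 1) := by
  induction n with
  | zero => simp
  | succ n ih => rw [sum_range_succ, ih, Nat.choose_succ_succ, add_comm]

lemma abs_cumulantGenerator_apply_le {C : ℝ} (hC : ∀ k, 1 ≤ k → |r k| ≤ C ^ k) {d : ℕ}
    (m n : Fin d) :
    |cumulantGenerator d r m n| ≤ if (m : ℕ) < n then (n : ℝ) * C ^ (n - m : ℕ) else 0 := by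
  rw [cumulantGenerator, Matrix.of_apply]
  split_ifs with hmn
  · have hm : ((m : ℕ) : ℝ) + 1 ≤ (n : ℕ) := by exact_mod_cast hmn
    rw [abs_mul, abs_of_nonneg (by positivity)]
    exact mul_le_mul hm (hC _ (by omega)) (abs_nonneg _) (by positivity)
  · rw [abs_zero]

lemma abs_cumulantGenerator_pow_apply_le {C : ℝ} (hC : ∀ k, 1 ≤ k → |r k| ≤ C ^ k) (d k : ℕ)
    (n : Fin (d + 1)) :
    |(cumulantGenerator (d + 1) r ^ k) 0 n| ≤ (n : ℕ).choose k * (n : ℝ) ^ k * C ^ (n : ℕ) := by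
  have hC0 : 0 ≤ C := (abs_nonneg _).trans ((hC 1 le_rfl).trans_eq (pow_one C))
  induction k generalizing n with
  | zero =>
    rw [pow_zero, Matrix.one_apply]
    split_ifs with h
    · simp [← h]
    · simpa using pow_nonneg hC0 _
  | succ k ih =>
    have hterm (m : Fin (d + 1)) :
        |(cumulantGenerator (d + 1) r ^ k) 0 m * cumulantGenerator (d + 1) r m n| ≤
          if (m : ℕ) < n then (m : ℕ).choose k * ((n : ℝ) ^ (k + 1) * C ^ (n : ℕ)) else 0 := by
      rw [abs_mul]
      refine (mul_le_mul (ih m) (abs_cumulantGenerator_apply_le hC m n) (abs_nonneg _)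
        (by positivity)).trans ?_
      split_ifs with hmn
      · rw [← pow_mul_pow_sub C hmn.le]
        calc _ ≤ (m : ℕ).choose k * (n : ℝ) ^ k * C ^ (m : ℕ) * (n * C ^ (n - m : ℕ)) := by gcongr
          _ = _ := by ring
      · rw [mul_zero]
    rw [pow_succ, Matrix.mul_apply]
    refine (abs_sum_le_sum_abs _ _).trans ((sum_le_sum fun m _ => hterm m).trans_eq ?_)
    rw [Fin.sum_univ_eq_sum_range (fun m => if m < (n : ℕ) then
        (m.choose k : ℝ) * ((n : ℝ) ^ (k + 1) * C ^ (n : ℕ)) else 0), ← sum_filter,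
      show (range (d + 1)).filter (· < (n : ℕ)) = range n by ext m; simp; omega,
      ← sum_mul, ← sum_range_choose_const, Nat.cast_sum, mul_assoc]

lemma abs_coeff_cumulantMomentSeries_le {C : ℝ} (hC : ∀ k, 1 ≤ k → |r k| ≤ C ^ k) (n : ℕ) :
    |coeff n (cumulantMomentSeries r)| ≤ (2 * Real.exp 1 * C) ^ n := by
  have hC0 : 0 ≤ C := (abs_nonneg _).trans ((hC 1 le_rfl).trans_eq (pow_one C))
  rw [coeff_cumulantMomentSeries]
  calc _ ≤ ∑ k ∈ range (n + 1), (n.choose k : ℝ) * (Real.exp n * C ^ n) := by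
        refine (abs_sum_le_sum_abs _ _).trans (sum_le_sum fun k _ => ?_)
        have hG := abs_cumulantGenerator_pow_apply_le hC n k (Fin.last n)
        rw [Fin.val_last] at hG
        rw [abs_mul, abs_of_nonneg (by positivity)]
        calc _ ≤ (k.factorial : ℝ)⁻¹ * (n.choose k * (n : ℝ) ^ k * C ^ n) := by gcongr
          _ = n.choose k * ((n : ℝ) ^ k / k.factorial * C ^ n) := by ring
          _ ≤ _ := by
            gcongr
            exact Real.pow_div_factorial_le_exp _ (Nat.cast_nonneg n) k
    _ = (2 * Real.exp 1 * C) ^ n := by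
        rw [← sum_mul, ← Nat.cast_sum, Nat.sum_range_choose, mul_pow, mul_pow, ← Real.exp_nat_mul,
          mul_one, Nat.cast_pow, Nat.cast_ofNat, mul_assoc]

end CumulantsToMoments

section MomentsFromPolynomials

open PowerSeries

variable {M : ℝ⟦X⟧} {p : ℕ → Polynomial ℝ}

lemma tendsto_natCast_mul_eval_inv {q : Polynomial ℝ} (hq : q.eval 0 = 0) :
    Tendsto (fun N : ℕ => (N : ℝ) * q.eval (N : ℝ)⁻¹) atTop (𝓝 (q.coeff 1)) := by
  have hdvd : q.divX * Polynomial.X = q := by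
    simpa [Polynomial.coeff_zero_eq_eval_zero, hq] using q.divX_mul_X_add
  have hlim : Tendsto (fun N : ℕ => q.divX.eval (N : ℝ)⁻¹) atTop (𝓝 (q.divX.eval 0)) :=
    (q.divX.continuous.tendsto 0).comp tendsto_inv_atTop_nhds_zero_nat
  rw [← Polynomial.coeff_zero_eq_eval_zero, Polynomial.coeff_divX, zero_add] at hlim
  refine hlim.congr' ?_
  filter_upwards [eventually_ne_atTop 0] with N hN
  nth_rw 2 [← hdvd]
  rw [Polynomial.eval_mul, Polynomial.eval_X, mul_comm _ (N : ℝ)⁻¹,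
    mul_inv_cancel_left₀ (Nat.cast_ne_zero.2 hN)]

lemma polynomial_ext_natCast {p q : Polynomial ℝ}
    (h : ∀ a : ℕ, p.eval (a : ℝ) = q.eval (a : ℝ)) : p = q :=
  Polynomial.eq_of_infinite_eval_eq p q
    ((Set.infinite_range_of_injective Nat.cast_injective).mono
      (Set.range_subset_iff.2 h))

lemma coeff_monotonePow_map_eval (hp : ∀ n N : ℕ, coeff n (monotonePow M N) = (p n).eval (N : ℝ))
    (n N : ℕ) (t : ℝ) :
    coeff n (monotonePow (PowerSeries.mk fun k => (p k).eval t) N) = (p n).eval (t * N) := by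
  set P : (Polynomial ℝ)⟦X⟧ := PowerSeries.mk p
  have hmap (t : ℝ) : PowerSeries.map (Polynomial.evalRingHom t) P =
      PowerSeries.mk fun k => (p k).eval t := by
    ext k; simp [P]
  have heval (t : ℝ) : (coeff n (monotonePow P N)).eval t =
      coeff n (monotonePow (PowerSeries.mk fun k => (p k).eval t) N) := by
    rw [← hmap, ← map_monotonePow, coeff_map, Polynomial.coe_evalRingHom]
  have hpoly : coeff n (monotonePow P N) =
      (p n).comp (Polynomial.X * Polynomial.C (N : ℝ)) := by
    refine polynomial_ext_natCast fun a => ?_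
    have ha : (PowerSeries.mk fun k => (p k).eval (a : ℝ)) = monotonePow M a := by
      ext k; rw [coeff_mk, hp]
    rw [heval, ha, ← monotonePow_mul, hp]
    simp
  rw [← heval, hpoly]
  simp

lemma eq_cumulantMomentSeries_of_coeff_one {r : ℕ → ℝ} (hM : constantCoeff M = 1)
    (hp : ∀ n, 1 ≤ n → ∀ N : ℕ, coeff n (monotonePow M N) = (p n).eval (N : ℝ))
    (hp1 : ∀ n, 1 ≤ n → (p n).coeff 1 = r n) : M = cumulantMomentSeries r := by
  set p' := Function.update p 0 1
  have hp' (n N : ℕ) : coeff n (monotonePow M N) = (p' n).eval (N : ℝ) := by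
    rcases Nat.eq_zero_or_pos n with rfl | hn
    · simp [p', constantCoeff_monotonePow hM]
    · simpa [p', hn.ne'] using hp n hn N
  have hcum (k : ℕ) (hk : 1 ≤ k) : Tendsto (fun N : ℕ => (N : ℝ) *
      coeff k (PowerSeries.mk fun k => (p' k).eval (N : ℝ)⁻¹)) atTop (𝓝 (r k)) := by
    have hk0 : k ≠ 0 := Nat.one_le_iff_ne_zero.1 hk
    have h0 : (p k).eval 0 = 0 := by
      simpa [monotonePow, coeff_one, hk0] using (hp k hk 0).symm
    simpa [p', hk0, hp1 k hk] using tendsto_natCast_mul_eval_inv h0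
  ext n
  refine tendsto_nhds_unique (tendsto_const_nhds.congr' ?_)
    (tendsto_coeff_monotonePow (Eventually.of_forall fun N => ?_) hcum n)
  · filter_upwards [eventually_ne_atTop 0] with N hN
    rw [coeff_monotonePow_map_eval hp', inv_mul_cancel₀ (Nat.cast_ne_zero.2 hN),
      ← Nat.cast_one (R := ℝ), ← hp' n 1, monotonePow_one]
  · simp [← coeff_zero_eq_constantCoeff_apply, p']

end MomentsFromPolynomials

/-! ### Sums of monotone independent elements -/

section MomentSeries

open PowerSeries

variable {R A : Type*} [CommRing R] [Ring A] [Algebra R A] (φ : A →ₗ[R] R)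

/-- The generating series of the moments `φ (a ^ n)`. -/
noncomputable def momentSeries (a : A) : R⟦X⟧ :=
  PowerSeries.mk fun n => φ (a ^ n)

lemma coeff_momentSeries (a : A) (n : ℕ) : coeff n (momentSeries φ a) = φ (a ^ n) :=
  coeff_mk _ _

lemma add_pow_succ_eq_sum_antidiagonal (T x : A) (n : ℕ) :
    (T + x) ^ (n + 1) = x ^ (n + 1) +
      ∑ p ∈ Finset.HasAntidiagonal.antidiagonal n, x ^ p.1 * (T * (T + x) ^ p.2) := by
  induction n with
  | zero => simp [add_comm]
  | succ n ih =>
    rw [pow_succ' _ (n + 1), add_mul, Finset.Nat.sum_antidiagonal_succ]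
    nth_rewrite 2 [ih]
    rw [mul_add, Finset.mul_sum]
    simp only [pow_zero, one_mul, pow_succ' x, mul_assoc]
    abel

variable {φ} {T x : A}

lemma mk_apply_pow_mul_add_pow
    (hx : ∀ q k, φ (T ^ q * x ^ k) = φ (x ^ k) * φ (T ^ q))
    (hxT : ∀ q k p, φ (T ^ q * (x ^ k * (T * (T + x) ^ p))) =
      φ (x ^ k) * φ (T ^ q * (T * (T + x) ^ p))) (q : ℕ) :
    (PowerSeries.mk fun n => φ (T ^ q * (T + x) ^ n)) =
      C (φ (T ^ q)) * momentSeries φ x +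
        X * momentSeries φ x * PowerSeries.mk fun n => φ (T ^ (q + 1) * (T + x) ^ n) := by
  ext (_ | n)
  · rw [map_add, coeff_C_mul, mul_assoc, coeff_zero_X_mul, add_zero, coeff_mk, coeff_momentSeries,
      mul_comm, ← hx, pow_zero, pow_zero]
  · rw [map_add, coeff_C_mul, mul_assoc, coeff_succ_X_mul, coeff_mul, coeff_mk, coeff_momentSeries,
      add_pow_succ_eq_sum_antidiagonal, mul_add, map_add, hx, Finset.mul_sum, map_sum, mul_comm]
    simp only [hxT, coeff_momentSeries, coeff_mk, pow_succ T, mul_assoc]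

lemma momentSeries_add_eq_monotoneConv
    (hx : ∀ q k, φ (T ^ q * x ^ k) = φ (x ^ k) * φ (T ^ q))
    (hxT : ∀ q k p, φ (T ^ q * (x ^ k * (T * (T + x) ^ p))) =
      φ (x ^ k) * φ (T ^ q * (T * (T + x) ^ p))) :
    momentSeries φ (T + x) = monotoneConv (momentSeries φ T) (momentSeries φ x) := by
  set M := momentSeries φ x
  have hiter (p : ℕ) : momentSeries φ (T + x) = (∑ q ∈ Finset.range p,
      C (φ (T ^ q)) * (X ^ q * M ^ (q + 1))) +
        X ^ p * (M ^ p * PowerSeries.mk fun n => φ (T ^ p * (T + x) ^ n)) := by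
    induction p with
    | zero => simp [momentSeries]
    | succ p ih =>
      rw [ih, Finset.sum_range_succ, mk_apply_pow_mul_add_pow hx hxT p]
      ring
  ext n
  rw [hiter (n + 1), map_add, map_sum, coeff_X_pow_mul', if_neg (by omega), add_zero, monotoneConv,
    coeff_mk]
  simp only [coeff_C_mul, coeff_momentSeries]

end MomentSeries

section Simplification

variable {A ι : Type*} [Ring A] [Algebra ℂ A] [LinearOrder ι]

/-- The word `w'` may replace the word `w` in the factorization rule: the product changes by a
scalar only, and an end of `w'` lies below every index `i` that the same end of `w` lies below. -/
structure IsSimplification (w w' : List (ι × A)) : Prop where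
  prod_eq : ∃ c : ℂ, (w.map Prod.snd).prod = c • (w'.map Prod.snd).prod
  getLast?_lt : ∀ i, (∀ p ∈ w.getLast?, p.1 < i) → ∀ p ∈ w'.getLast?, p.1 < i
  head?_lt : ∀ i, (∀ p ∈ w.head?, p.1 < i) → ∀ p ∈ w'.head?, p.1 < i

lemma IsSimplification.trans {w w' w'' : List (ι × A)} (h : IsSimplification w w')
    (h' : IsSimplification w' w'') : IsSimplification w w'' where
  prod_eq := by
    obtain ⟨⟨c, hc⟩, ⟨d, hd⟩⟩ := And.intro h.prod_eq h'.prod_eq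
    exact ⟨c * d, by rw [hc, hd, smul_smul]⟩
  getLast?_lt i := h'.getLast?_lt i ∘ h.getLast?_lt i
  head?_lt i := h'.head?_lt i ∘ h.head?_lt i

lemma isSimplification_nil {w : List (ι × A)} (hw : (w.map Prod.snd).prod = 0) :
    IsSimplification w [] where
  prod_eq := ⟨0, by rw [hw, zero_smul]⟩
  getLast?_lt := by simp
  head?_lt := by simp

lemma isSimplification_erase_algebraMap {j : ι} (hj : ∀ i, ¬ j < i) (c : ℂ)
    (u v : List (ι × A)) : IsSimplification (u ++ (j, algebraMap ℂ A c) :: v) (u ++ v) where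
  prod_eq := ⟨c, by simp [Algebra.algebraMap_eq_smul_one]⟩
  getLast?_lt i h := by
    rcases v.eq_nil_or_concat with rfl | ⟨v, q, rfl⟩
    · exact absurd (h (j, algebraMap ℂ A c) (by simp)) (hj i)
    · simpa [List.getLast?_append, List.getLast?_cons] using h
  head?_lt i h := by
    rcases u with _ | ⟨q, u⟩
    · exact absurd (h (j, algebraMap ℂ A c) (by simp)) (hj i)
    · simpa using h

lemma isSimplification_merge (j : ι) (a b : A) (u v : List (ι × A)) :
    IsSimplification (u ++ (j, a) :: (j, b) :: v) (u ++ (j, a * b) :: v) where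
  prod_eq := ⟨1, by simp [mul_assoc]⟩
  getLast?_lt i h := by
    rcases v.eq_nil_or_concat with rfl | ⟨v, q, rfl⟩ <;>
      simpa [List.getLast?_append, List.getLast?_cons] using h
  head?_lt i h := by
    rcases u with _ | ⟨q, u⟩ <;> simpa using h

end Simplification

section Factorization

lemma map_algebraMap_of_map_one {R A : Type*} [CommSemiring R] [Semiring A] [Algebra R A]
    {φ : A →ₗ[R] R} (h1 : φ 1 = 1) (c : R) : φ (algebraMap R A c) = c := by
  rw [Algebra.algebraMap_eq_smul_one, map_smul, h1, smul_eq_mul, mul_one]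

variable {A ι : Type*} [Ring A] [StarRing A] [Algebra ℂ A] [LinearOrder ι]
  {φ : A →ₗ[ℂ] ℂ} {S : ι → NonUnitalStarSubalgebra ℂ A}

/-- The words to which the definition of monotone independence applies: no letter is a scalar, and
neighbouring letters come from different algebras. -/
def IsReducedWord (S : ι → NonUnitalStarSubalgebra ℂ A) (w : List (ι × A)) : Prop :=
  (∀ p ∈ w, p.2 ∈ S p.1 ∧ p.2 ∉ Set.range (algebraMap ℂ A)) ∧
    w.IsChain fun p q => p.1 ≠ q.1

namespace MonotoneIndepAlg

lemma map_word_of_isReducedWord (hind : MonotoneIndepAlg φ S) {u v : List (ι × A)} {i : ι} {a : A}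
    (hu : IsReducedWord S u) (hv : IsReducedWord S v)
    (ha : a ∈ S i) (ha' : a ∉ Set.range (algebraMap ℂ A))
    (hui : ∀ p ∈ u.getLast?, p.1 < i) (hvi : ∀ p ∈ v.head?, p.1 < i) :
    φ ((u.map Prod.snd).prod * a * (v.map Prod.snd).prod) =
      φ a * φ ((u.map Prod.snd).prod * (v.map Prod.snd).prod) := by
  have hletters : ∀ p ∈ u ++ (i, a) :: v, p.2 ∈ S p.1 ∧ p.2 ∉ Set.range (algebraMap ℂ A) := by
    intro p hp
    rcases List.mem_append.1 hp with hp | hp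
    · exact hu.1 p hp
    · rcases List.mem_cons.1 hp with rfl | hp
      · exact ⟨ha, ha'⟩
      · exact hv.1 p hp
  have hchain : ((u ++ (i, a) :: v).map Prod.fst).IsChain (· ≠ ·) := by
    rw [List.isChain_map, List.isChain_append, List.isChain_cons]
    refine ⟨hu.2, ⟨fun p hp => (hvi p hp).ne', hv.2⟩, fun p hp q hq => ?_⟩
    obtain rfl : (i, a) = q := by simpa using hq
    exact (hui p hp).ne
  simpa [mul_assoc] using hind u v i a hletters hchain hui hvi

lemma map_mul (hind : MonotoneIndepAlg φ S) (h1 : φ 1 = 1) {i j : ι} (hij : i ≠ j) {a b : A}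
    (ha : a ∈ S i) (hb : b ∈ S j) : φ (a * b) = φ a * φ b := by
  by_cases ha' : a ∈ Set.range (algebraMap ℂ A)
  · obtain ⟨c, rfl⟩ := ha'
    rw [← Algebra.smul_def, map_smul, smul_eq_mul, map_algebraMap_of_map_one h1]
  by_cases hb' : b ∈ Set.range (algebraMap ℂ A)
  · obtain ⟨c, rfl⟩ := hb'
    rw [← Algebra.commutes, ← Algebra.smul_def, map_smul, smul_eq_mul,
      map_algebraMap_of_map_one h1, mul_comm]
  have hnil : IsReducedWord S [] := ⟨by simp, by simp⟩
  have hsingle {k : ι} {x : A} (hx : x ∈ S k) (hx' : x ∉ Set.range (algebraMap ℂ A)) :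
      IsReducedWord S [(k, x)] := ⟨by simpa [-Set.mem_range] using ⟨hx, hx'⟩, by simp⟩
  rcases hij.lt_or_gt with h | h
  · simpa [mul_comm] using
      hind.map_word_of_isReducedWord (hsingle ha ha') hnil hb hb' (by simpa using h) (by simp)
  · simpa using
      hind.map_word_of_isReducedWord hnil (hsingle hb hb') ha ha' (by simp) (by simpa using h)

lemma map_mul_mul (hind : MonotoneIndepAlg φ S) {i j : ι} (hij : i < j) {a b y : A}
    (hy : y ∈ S i) (ha : a ∈ S j) (hb : b ∈ S j) (hy' : y ∉ Set.range (algebraMap ℂ A))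
    (ha' : a ∉ Set.range (algebraMap ℂ A)) (hb' : b ∉ Set.range (algebraMap ℂ A)) :
    φ (a * (y * b)) = φ a * φ (y * b) := by
  have hyb : IsReducedWord S [(i, y), (j, b)] :=
    ⟨by simpa [-Set.mem_range] using ⟨⟨hy, hy'⟩, hb, hb'⟩, by simpa using hij.ne⟩
  simpa using hind.map_word_of_isReducedWord (u := []) ⟨by simp, by simp⟩ hyb ha ha' (by simp)
    (by simpa using hij)

-- Apply `map_mul_mul` to `a y b` and to `a (y + 1) b`, and subtract.
lemma map_mul_of_one_mem (hind : MonotoneIndepAlg φ S) {i j : ι} (hij : i < j)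
    (hone : 1 ∈ S i) {a b y : A} (hy : y ∈ S i) (hy' : y ∉ Set.range (algebraMap ℂ A))
    (ha : a ∈ S j) (hb : b ∈ S j)
    (ha' : a ∉ Set.range (algebraMap ℂ A)) (hb' : b ∉ Set.range (algebraMap ℂ A)) :
    φ (a * b) = φ a * φ b := by
  have hy1 : y + 1 ∉ Set.range (algebraMap ℂ A) := by
    rintro ⟨c, hc⟩
    exact hy' ⟨c - 1, by rw [map_sub, hc, map_one, add_sub_cancel_right]⟩
  have h := hind.map_mul_mul hij (add_mem hy hone) ha hb hy1 ha' hb'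
  rwa [add_mul, one_mul, mul_add, map_add, map_add, mul_add,
    hind.map_mul_mul hij hy ha hb hy' ha' hb', add_right_inj] at h

end MonotoneIndepAlg

lemma exists_isSimplification_length_lt (hS : ∀ i j, i < j → (1 : A) ∉ S i) {w : List (ι × A)}
    (hw : ∀ p ∈ w, p.2 ∈ S p.1) (hred : ¬ IsReducedWord S w) :
    ∃ w' : List (ι × A), w'.length < w.length ∧ (∀ p ∈ w', p.2 ∈ S p.1) ∧
      IsSimplification w w' := by
  by_cases hscalar : ∃ p ∈ w, p.2 ∈ Set.range (algebraMap ℂ A)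
  · obtain ⟨⟨j, -⟩, hp, c, rfl⟩ := hscalar
    obtain ⟨u, v, rfl⟩ := List.append_of_mem hp
    rcases eq_or_ne c 0 with rfl | hc
    · exact ⟨[], by simp, by simp, isSimplification_nil (by simp)⟩
    have hone : (1 : A) ∈ S j := by
      have hmem := SMulMemClass.smul_mem c⁻¹ (hw _ hp)
      rwa [Algebra.algebraMap_eq_smul_one, inv_smul_smul₀ hc] at hmem
    exact ⟨u ++ v, by simp, fun p hp => hw p (by simp at hp ⊢; tauto),
      isSimplification_erase_algebraMap (fun i hi => hS j i hi hone) c u v⟩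
  · have hchain : ¬ w.IsChain fun p q => p.1 ≠ q.1 := fun h =>
      hred ⟨fun p hp => ⟨hw p hp, fun h => hscalar ⟨p, hp, h⟩⟩, h⟩
    simp only [List.isChain_iff_forall_rel_of_append_cons_cons, not_forall, not_not] at hchain
    obtain ⟨⟨j, a⟩, ⟨_, b⟩, u, v, rfl, rfl⟩ := hchain
    refine ⟨u ++ (j, a * b) :: v, by simp, fun p hp => ?_, isSimplification_merge j a b u v⟩
    simp only [List.mem_append, List.mem_cons] at hp
    rcases hp with hp | rfl | hp
    · exact hw p (by simp [hp])
    · exact mul_mem (hw (j, a) (by simp)) (hw (j, b) (by simp))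
    · exact hw p (by simp [hp])

lemma exists_isSimplification_isReducedWord (hS : ∀ i j, i < j → (1 : A) ∉ S i)
    (w : List (ι × A)) (hw : ∀ p ∈ w, p.2 ∈ S p.1) :
    ∃ w' : List (ι × A), IsReducedWord S w' ∧ IsSimplification w w' := by
  induction hn : w.length using Nat.strong_induction_on generalizing w with
  | _ n ih =>
  by_cases hred : IsReducedWord S w
  · exact ⟨w, hred, ⟨1, (one_smul _ _).symm⟩, fun _ => id, fun _ => id⟩
  obtain ⟨w', hlen, hw', hsimp⟩ := exists_isSimplification_length_lt hS hw hred
  obtain ⟨w'', hred', hsimp'⟩ := ih _ (hn ▸ hlen) w' hw' rfl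
  exact ⟨w'', hred', hsimp.trans hsimp'⟩

lemma MonotoneIndepAlg.map_word (hind : MonotoneIndepAlg φ S) (h1 : φ 1 = 1)
    (hS : ∀ i j, i < j → (1 : A) ∉ S i) {u v : List (ι × A)} {i : ι} {a : A}
    (hu : ∀ p ∈ u, p.2 ∈ S p.1) (hv : ∀ p ∈ v, p.2 ∈ S p.1) (ha : a ∈ S i)
    (hui : ∀ p ∈ u.getLast?, p.1 < i) (hvi : ∀ p ∈ v.head?, p.1 < i) :
    φ ((u.map Prod.snd).prod * a * (v.map Prod.snd).prod) =
      φ a * φ ((u.map Prod.snd).prod * (v.map Prod.snd).prod) := by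
  by_cases ha' : a ∈ Set.range (algebraMap ℂ A)
  · obtain ⟨c, rfl⟩ := ha'
    rw [map_algebraMap_of_map_one h1, ← Algebra.commutes, ← Algebra.smul_def, smul_mul_assoc,
      map_smul, smul_eq_mul]
  obtain ⟨u', hu', hsu⟩ := exists_isSimplification_isReducedWord hS u hu
  obtain ⟨v', hv', hsv⟩ := exists_isSimplification_isReducedWord hS v hv
  obtain ⟨⟨c, hc⟩, ⟨d, hd⟩⟩ := And.intro hsu.prod_eq hsv.prod_eq
  rw [hc, hd]
  simp only [smul_mul_assoc, mul_smul_comm, map_smul, smul_eq_mul]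
  rw [hind.map_word_of_isReducedWord hu' hv' ha ha' (hsu.getLast?_lt i hui)
    (hsv.head?_lt i hvi)]
  ring

end Factorization

section Sums

lemma eqOn_adjoin_image {R A M ι : Type*} [CommSemiring R] [Semiring A] [Algebra R A]
    [AddCommMonoid M] [Module R M] {x : ι → A} {t : Set ι} {f g : A →ₗ[R] M}
    (h : ∀ u : List ι, (∀ j ∈ u, j ∈ t) → f (u.map x).prod = g (u.map x).prod) :
    Set.EqOn f g (Algebra.adjoin R (x '' t)) := by
  intro a ha
  rw [SetLike.mem_coe, ← Subalgebra.mem_toSubmodule, Algebra.adjoin_eq_span] at ha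
  refine LinearMap.eqOn_span (fun b hb => ?_) ha
  obtain ⟨l, hl, rfl⟩ := Submonoid.exists_list_of_mem_closure hb
  choose y hyt hxy using hl
  simpa [List.map_pmap, hxy] using
    h (l.pmap y fun _ => id) (by simpa [List.mem_pmap] using fun j a ha hj => hj ▸ hyt a ha)

lemma sum_mem_adjoin_image {R A ι : Type*} [CommSemiring R] [Semiring A] [Algebra R A] {x : ι → A}
    {t : Set ι} {s : Finset ι} (hs : ∀ j ∈ s, j ∈ t) :
    ∑ j ∈ s, x j ∈ Algebra.adjoin R (x '' t) :=
  sum_mem fun j hj => Algebra.subset_adjoin ⟨j, hs j hj, rfl⟩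

variable {A ι : Type*} [Ring A] [StarRing A] [Algebra ℂ A] [LinearOrder ι]
  {φ : A →ₗ[ℂ] ℂ} {S : ι → NonUnitalStarSubalgebra ℂ A} {x : ι → A}

namespace MonotoneIndepAlg

lemma map_prod_mul_prod (hind : MonotoneIndepAlg φ S) (h1 : φ 1 = 1)
    (hS : ∀ i j, i < j → (1 : A) ∉ S i) (hx : ∀ i, x i ∈ S i) {u v : List ι} {i : ι} {a : A}
    (ha : a ∈ S i) (hui : ∀ j ∈ u.getLast?, j < i) (hvi : ∀ j ∈ v.head?, j < i) :
    φ ((u.map x).prod * a * (v.map x).prod) = φ a * φ ((u.map x).prod * (v.map x).prod) := by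
  have hword (w : List ι) : ∀ p ∈ w.map fun j => (j, x j), p.2 ∈ S p.1 := by
    simpa using fun j _ => hx j
  simpa [Function.comp_def] using hind.map_word h1 hS (hword u) (hword v) ha
    (by simpa using hui) (by simpa using hvi)

lemma map_mul_of_mem_adjoin (hind : MonotoneIndepAlg φ S) (h1 : φ 1 = 1)
    (hS : ∀ i j, i < j → (1 : A) ∉ S i) (hx : ∀ i, x i ∈ S i) {t : Set ι} {i : ι}
    (ht : ∀ j ∈ t, j < i) {U a : A} (hU : U ∈ Algebra.adjoin ℂ (x '' t)) (ha : a ∈ S i) :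
    φ (U * a) = φ a * φ U := by
  refine eqOn_adjoin_image (f := φ ∘ₗ LinearMap.mulRight ℂ a) (g := φ a • φ) (fun u hu => ?_) hU
  simpa using hind.map_prod_mul_prod h1 hS hx (v := []) ha
    (fun j hj => ht j (hu j (List.mem_of_getLast? hj))) (by simp)

lemma map_mul_mul_sum_mul_of_mem_adjoin (hind : MonotoneIndepAlg φ S) (h1 : φ 1 = 1)
    (hS : ∀ i j, i < j → (1 : A) ∉ S i) (hx : ∀ i, x i ∈ S i) {s : Finset ι} {i : ι}
    (hs : ∀ j ∈ s, j < i) {U a Z : A} (hU : U ∈ Algebra.adjoin ℂ (x '' s)) (ha : a ∈ S i)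
    (hZ : Z ∈ Algebra.adjoin ℂ (x '' Set.univ)) :
    φ (U * (a * ((∑ j ∈ s, x j) * Z))) = φ a * φ (U * ((∑ j ∈ s, x j) * Z)) := by
  refine eqOn_adjoin_image
    (f := φ ∘ₗ LinearMap.mulRight ℂ (a * ((∑ j ∈ s, x j) * Z)))
    (g := φ a • φ ∘ₗ LinearMap.mulRight ℂ ((∑ j ∈ s, x j) * Z)) (fun u hu => ?_) hU
  refine eqOn_adjoin_image
    (f := φ ∘ₗ LinearMap.mulLeft ℂ (u.map x).prod ∘ₗ LinearMap.mulLeft ℂ a ∘ₗ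
      LinearMap.mulLeft ℂ (∑ j ∈ s, x j))
    (g := φ a • φ ∘ₗ LinearMap.mulLeft ℂ (u.map x).prod ∘ₗ LinearMap.mulLeft ℂ (∑ j ∈ s, x j))
    (fun v _ => ?_) hZ
  simp only [LinearMap.comp_apply, LinearMap.mulLeft_apply, LinearMap.smul_apply, smul_eq_mul,
    Finset.mul_sum, Finset.sum_mul, map_sum]
  refine Finset.sum_congr rfl fun j hj => ?_
  simpa [mul_assoc] using hind.map_prod_mul_prod h1 hS hx (v := j :: v) ha
    (fun k hk => hs k (hu k (List.mem_of_getLast? hk))) (by simpa using hs j hj)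

lemma momentSeries_sum_add (hind : MonotoneIndepAlg φ S) (h1 : φ 1 = 1)
    (hS : ∀ i j, i < j → (1 : A) ∉ S i) (hx : ∀ i, x i ∈ S i) {s : Finset ι} {i : ι}
    (hs : ∀ j ∈ s, j < i) :
    momentSeries φ (∑ j ∈ s, x j + x i) =
      monotoneConv (momentSeries φ (∑ j ∈ s, x j)) (momentSeries φ (x i)) := by
  have hT (q : ℕ) : (∑ j ∈ s, x j) ^ q ∈ Algebra.adjoin ℂ (x '' s) :=
    pow_mem (sum_mem_adjoin_image fun j hj => hj) q
  have hZ (p : ℕ) : (∑ j ∈ s, x j + x i) ^ p ∈ Algebra.adjoin ℂ (x '' Set.univ) :=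
    pow_mem (add_mem (sum_mem_adjoin_image fun j _ => Set.mem_univ j)
      (Algebra.subset_adjoin ⟨i, Set.mem_univ i, rfl⟩)) p
  have hpow (k : ℕ) : x i ^ (k + 1) ∈ S i := by
    induction k with
    | zero => simpa using hx i
    | succ k ih => exact pow_succ (x i) (k + 1) ▸ mul_mem ih (hx i)
  refine momentSeries_add_eq_monotoneConv (fun q k => ?_) fun q k p => ?_ <;>
    rcases k with _ | k
  · rw [pow_zero, mul_one, h1, one_mul]
  · exact hind.map_mul_of_mem_adjoin h1 hS hx hs (hT q) (hpow k)
  · rw [pow_zero, one_mul, h1, one_mul]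
  · exact hind.map_mul_mul_sum_mul_of_mem_adjoin h1 hS hx hs (hT q) (hpow k) (hZ p)

lemma momentSeries_sum (hind : MonotoneIndepAlg φ S) (h1 : φ 1 = 1)
    (hS : ∀ i j, i < j → (1 : A) ∉ S i) (hx : ∀ i, x i ∈ S i) {M : PowerSeries ℂ}
    (hM : ∀ i, momentSeries φ (x i) = M) (s : Finset ι) :
    momentSeries φ (∑ i ∈ s, x i) = monotonePow M s.card := by
  induction s using Finset.induction_on_max with
  | empty =>
    ext (_ | n) <;> simp [coeff_momentSeries, monotonePow, h1, PowerSeries.coeff_one]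
  | insert i s hs ih =>
    have hi : i ∉ s := fun hi => lt_irrefl _ (hs i hi)
    rw [Finset.sum_insert hi, add_comm, hind.momentSeries_sum_add h1 hS hx hs, ih, hM,
      Finset.card_insert_of_notMem hi, monotonePow]

lemma one_notMem (hind : MonotoneIndepAlg φ S) {i j : ι} (hij : i < j) {y a : A}
    (hy : y ∈ S i) (hy' : y ∉ Set.range (algebraMap ℂ A)) (ha : a ∈ S j)
    (ha' : a ∉ Set.range (algebraMap ℂ A)) (hvar : φ (a ^ 2) ≠ φ a ^ 2) : (1 : A) ∉ S i :=
  fun hone => hvar <| by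
    simpa [sq] using hind.map_mul_of_one_mem hij hone hy hy' ha ha ha' ha'

end MonotoneIndepAlg

lemma notMem_range_algebraMap_of_map_sq_ne {R A : Type*} [CommSemiring R] [Semiring A]
    [Algebra R A] {φ : A →ₗ[R] R} (h1 : φ 1 = 1) {a : A} (ha : φ (a ^ 2) ≠ φ a ^ 2) :
    a ∉ Set.range (algebraMap R A) := by
  rintro ⟨c, rfl⟩
  exact ha (by rw [← map_pow, map_algebraMap_of_map_one h1, map_algebraMap_of_map_one h1])

namespace MonotoneIndep

variable [StarModule ℂ A]

lemma momentSeries_sum (hind : MonotoneIndep φ x) (h1 : φ 1 = 1) {M : PowerSeries ℂ}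
    (hM : ∀ i, momentSeries φ (x i) = M)
    (hvar : PowerSeries.coeff 2 M ≠ PowerSeries.coeff 1 M ^ 2) (s : Finset ι) :
    momentSeries φ (∑ i ∈ s, x i) = monotonePow M s.card := by
  have hvar' (i : ι) : φ (x i ^ 2) ≠ φ (x i) ^ 2 := by
    simpa [← hM i, coeff_momentSeries] using hvar
  have hscalar (i : ι) := notMem_range_algebraMap_of_map_sq_ne h1 (hvar' i)
  have hself (i : ι) : x i ∈ NonUnitalStarAlgebra.adjoin ℂ {x i} :=
    NonUnitalStarAlgebra.subset_adjoin ℂ {x i} rfl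
  exact MonotoneIndepAlg.momentSeries_sum hind h1 (fun i j hij => MonotoneIndepAlg.one_notMem hind
    hij (hself i) (hscalar i) (hself j) (hscalar j) (hvar' j)) hself hM s

lemma map_sum_sq (hind : MonotoneIndep φ x) (h1 : φ 1 = 1) {m : ℂ} (hm : ∀ i, φ (x i) = m)
    (hm2 : ∀ i, φ (x i ^ 2) = m ^ 2) (s : Finset ι) :
    φ ((∑ i ∈ s, x i) ^ 2) = s.card ^ 2 * m ^ 2 := by
  have hmul (i j : ι) : φ (x i * x j) = m ^ 2 := by
    rcases eq_or_ne i j with rfl | hij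
    · rw [← sq, hm2]
    · rw [MonotoneIndepAlg.map_mul hind h1 hij (NonUnitalStarAlgebra.subset_adjoin ℂ {x i} rfl)
        (NonUnitalStarAlgebra.subset_adjoin ℂ {x j} rfl), hm, hm, sq]
  simp only [sq (∑ i ∈ s, x i), Finset.sum_mul_sum, map_sum, hmul, Finset.sum_const, nsmul_eq_mul]
  ring

end MonotoneIndep

end Sums

/-! ### The moment problem -/

section MomentProblem

/-- The real sequence `a` is the moment sequence of `μ`; in particular all moments exist. -/
def HasMoments (μ : ProbabilityMeasure ℝ) (a : ℕ → ℝ) : Prop :=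
  ∀ k : ℕ, Integrable (fun x : ℝ => x ^ k) (μ : Measure ℝ) ∧ ∫ x : ℝ, x ^ k ∂(μ : Measure ℝ) = a k

variable {μ ν : ProbabilityMeasure ℝ} {a : ℕ → ℝ} {C : ℝ}

namespace HasMoments

lemma measureReal_le_abs_mul_pow_le (h : HasMoments μ a) {r : ℝ} (hr : 0 ≤ r) (k : ℕ) :
    r ^ (2 * k) * (μ : Measure ℝ).real {x | r ≤ |x|} ≤ a (2 * k) := by
  have hmarkov := mul_meas_ge_le_integral_of_nonneg (μ := (μ : Measure ℝ))
    (f := fun x : ℝ => x ^ (2 * k)) (Eventually.of_forall fun x => (even_two_mul k).pow_nonneg x)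
    (h (2 * k)).1 (r ^ (2 * k))
  rw [(h (2 * k)).2] at hmarkov
  refine (mul_le_mul_of_nonneg_left (measureReal_mono fun x hx => ?_) (by positivity)).trans hmarkov
  rw [Set.mem_ofPred_eq, ← (even_two_mul k).pow_abs x]
  exact pow_le_pow_left₀ hr hx _

lemma ae_abs_le (h : HasMoments μ a) (hC : ∀ k, |a k| ≤ C ^ k) :
    ∀ᵐ x ∂(μ : Measure ℝ), |x| ≤ C + 1 := by
  have hC0 : 0 ≤ C := by simpa using (abs_nonneg _).trans (hC 1)
  have hle (k : ℕ) : (μ : Measure ℝ).real {x | C + 1 ≤ |x|} ≤ ((C / (C + 1)) ^ 2) ^ k := by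
    rw [← pow_mul, div_pow, le_div_iff₀' (by positivity)]
    exact (h.measureReal_le_abs_mul_pow_le (by positivity) k).trans ((le_abs_self _).trans (hC _))
  have hlim : Tendsto (fun k : ℕ => ((C / (C + 1)) ^ 2) ^ k) atTop (𝓝 0) := by
    refine tendsto_pow_atTop_nhds_zero_of_lt_one (by positivity)
      (pow_lt_one₀ (by positivity) ?_ two_ne_zero)
    rw [div_lt_one (by positivity)]
    exact lt_add_one C
  have hzero : (μ : Measure ℝ).real {x | C + 1 ≤ |x|} = 0 :=
    le_antisymm (ge_of_tendsto' hlim hle) measureReal_nonneg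
  rw [measureReal_eq_zero_iff, measure_eq_zero_iff_ae_notMem] at hzero
  filter_upwards [hzero] with x hx using (not_le.1 hx).le

lemma hasSum_charFun (h : HasMoments μ a) (hC : ∀ k, |a k| ≤ C ^ k) (t : ℝ) :
    HasSum (fun k : ℕ => (t * Complex.I) ^ k / k.factorial * a k) (charFun (μ : Measure ℝ) t) := by
  have hexp (x : ℝ) : ∑' k : ℕ, (t * Complex.I) ^ k / k.factorial * ((x ^ k : ℝ) : ℂ) =
      Complex.exp (t * x * Complex.I) := by
    rw [Complex.exp_eq_exp_ℂ, NormedSpace.exp_eq_tsum_div]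
    refine tsum_congr fun k => ?_
    push_cast
    ring
  have hint (k : ℕ) : Integrable
      (fun x : ℝ => (t * Complex.I) ^ k / k.factorial * ((x ^ k : ℝ) : ℂ)) (μ : Measure ℝ) :=
    (h k).1.ofReal.const_mul _
  have hnorm (k : ℕ) : ∫ x : ℝ, ‖(t * Complex.I) ^ k / k.factorial * ((x ^ k : ℝ) : ℂ)‖
      ∂(μ : Measure ℝ) ≤ (|t| * (C + 1)) ^ k / k.factorial := by
    refine (integral_mono_ae (hint k).norm (integrable_const _) ?_).trans_eq
      (by rw [integral_const, probReal_univ, one_smul])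
    filter_upwards [h.ae_abs_le hC] with x hx
    simp only [norm_mul, norm_div, norm_pow, Complex.norm_real, Complex.norm_I, Real.norm_eq_abs,
      RCLike.norm_natCast, one_pow, mul_one, mul_pow, mul_div_right_comm]
    gcongr
  have hsum := hasSum_integral_of_summable_integral_norm hint
    ((Real.summable_pow_div_factorial (|t| * (C + 1))).of_nonneg_of_le
      (fun k => integral_nonneg fun x => norm_nonneg _) hnorm)
  simpa only [hexp, integral_const_mul, integral_complex_ofReal, (h _).2, ← charFun_apply_real]
    using hsum

lemma unique (hμ : HasMoments μ a) (hν : HasMoments ν a) (hC : ∀ k, |a k| ≤ C ^ k) : μ = ν :=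
  Subtype.ext <| Measure.ext_of_charFun (μ := (μ : Measure ℝ)) (ν := (ν : Measure ℝ)) <|
    funext fun t => (hμ.hasSum_charFun hC t).unique (hν.hasSum_charFun hC t)

end HasMoments

section WeakLimits

lemma integrable_add_const_sq_and_integral {Ω : Type*} [MeasurableSpace Ω] {ρ : Measure Ω}
    [IsProbabilityMeasure ρ] {f : Ω → ℝ} (hf : Integrable f ρ)
    (hf2 : Integrable (fun x => f x ^ 2) ρ) (s : ℝ) :
    Integrable (fun x => (f x + s) ^ 2) ρ ∧
      ∫ x, (f x + s) ^ 2 ∂ρ = ∫ x, f x ^ 2 ∂ρ + 2 * s * ∫ x, f x ∂ρ + s ^ 2 := by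
  have hexpand : (fun x => (f x + s) ^ 2) = fun x => f x ^ 2 + 2 * s * f x + s ^ 2 := by
    ext x
    ring
  have hi : Integrable (fun x => f x ^ 2 + 2 * s * f x) ρ := hf2.add (hf.const_mul (2 * s))
  rw [hexpand, integral_add hi (integrable_const _), integral_add hf2 (hf.const_mul _),
    integral_const_mul, integral_const, probReal_univ, one_smul]
  exact ⟨hi.add (integrable_const _), rfl⟩

variable {Ω : Type*} [TopologicalSpace Ω] [MeasurableSpace Ω] [OpensMeasurableSpace Ω]
  [HasOuterApproxClosed Ω] {μ : ℕ → ProbabilityMeasure Ω} {ν : ProbabilityMeasure Ω} {f : Ω → ℝ}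
  {b c : ℝ}

lemma integrable_and_integral_le_of_tendsto (hμ : Tendsto μ atTop (𝓝 ν)) (hf : Continuous f)
    (h0 : 0 ≤ f) (hint : ∀ N, Integrable f (μ N : Measure Ω))
    (hc : Tendsto (fun N => ∫ x, f x ∂(μ N : Measure Ω)) atTop (𝓝 c)) :
    Integrable f (ν : Measure Ω) ∧ ∫ x, f x ∂(ν : Measure Ω) ≤ c := by
  have hlintegral : ∫⁻ x, ENNReal.ofReal (f x) ∂(ν : Measure Ω) ≤ ENNReal.ofReal c := by
    refine (lintegral_le_liminf_lintegral_of_forall_isOpen_measure_le_liminf_measure hf h0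
      fun G hG => ProbabilityMeasure.le_liminf_measure_open_of_tendsto hμ hG).trans_eq ?_
    refine ((ENNReal.tendsto_ofReal hc).congr fun N => ?_).liminf_eq
    exact ofReal_integral_eq_lintegral_ofReal (hint N) (Eventually.of_forall h0)
  have hi : Integrable f (ν : Measure Ω) := by
    refine ⟨hf.measurable.aestronglyMeasurable, ?_⟩
    rw [hasFiniteIntegral_iff_ofReal (Eventually.of_forall h0)]
    exact hlintegral.trans_lt ENNReal.ofReal_lt_top
  rw [← ofReal_integral_eq_lintegral_ofReal hi (Eventually.of_forall h0),
    ENNReal.ofReal_le_ofReal_iff (ge_of_tendsto' hc fun N => integral_nonneg h0)] at hlintegral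
  exact ⟨hi, hlintegral⟩

-- The bound `∫ (f + s)² dν ≤ lim ∫ (f + s)² dμ_N` is affine in `s ∈ ℝ`, so its slope vanishes.
lemma integral_eq_of_tendsto_of_tendsto_sq (hμ : Tendsto μ atTop (𝓝 ν)) (hf : Continuous f)
    (hint : ∀ N, Integrable f (μ N : Measure Ω))
    (hint2 : ∀ N, Integrable (fun x => f x ^ 2) (μ N : Measure Ω))
    (hb : Tendsto (fun N => ∫ x, f x ^ 2 ∂(μ N : Measure Ω)) atTop (𝓝 b))
    (hc : Tendsto (fun N => ∫ x, f x ∂(μ N : Measure Ω)) atTop (𝓝 c)) :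
    Integrable f (ν : Measure Ω) ∧ ∫ x, f x ∂(ν : Measure Ω) = c := by
  have hi2 : Integrable (fun x => f x ^ 2) (ν : Measure Ω) :=
    (integrable_and_integral_le_of_tendsto hμ (hf.pow 2) (fun x => sq_nonneg (f x)) hint2 hb).1
  have hi : Integrable f (ν : Measure Ω) :=
    ((memLp_two_iff_integrable_sq hf.measurable.aestronglyMeasurable).2 hi2).integrable one_le_two
  have haffine (s : ℝ) : ∫ x, f x ^ 2 ∂(ν : Measure Ω) + 2 * s * ∫ x, f x ∂(ν : Measure Ω) + s ^ 2
      ≤ b + 2 * s * c + s ^ 2 := by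
    rw [← (integrable_add_const_sq_and_integral hi hi2 s).2]
    refine (integrable_and_integral_le_of_tendsto hμ ((hf.add_const s).pow 2)
      (fun x => sq_nonneg (f x + s))
      (fun N => (integrable_add_const_sq_and_integral (hint N) (hint2 N) s).1) ?_).2
    exact ((hb.add (hc.const_mul (2 * s))).add_const (s ^ 2)).congr
      fun N => (integrable_add_const_sq_and_integral (hint N) (hint2 N) s).2.symm
  refine ⟨hi, by_contra fun hne => ?_⟩
  have hslope := haffine ((b - ∫ x, f x ^ 2 ∂(ν : Measure Ω) + 1) /
    (2 * (∫ x, f x ∂(ν : Measure Ω) - c)))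
  have hne' : ∫ x, f x ∂(ν : Measure Ω) - c ≠ 0 := sub_ne_zero.2 hne
  have hcancel : 2 * ((b - ∫ x, f x ^ 2 ∂(ν : Measure Ω) + 1) /
      (2 * (∫ x, f x ∂(ν : Measure Ω) - c))) * (∫ x, f x ∂(ν : Measure Ω) - c) =
      b - ∫ x, f x ^ 2 ∂(ν : Measure Ω) + 1 := by
    field_simp
  linarith

end WeakLimits

variable {μ : ℕ → ProbabilityMeasure ℝ} {m : ℕ → ℕ → ℝ}

lemma exists_subseq_tendsto_of_hasMoments (hμ : ∀ N, HasMoments (μ N) (m N)) {K : ℝ}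
    (hK : ∀ N, m N 2 ≤ K) :
    ∃ (ν : ProbabilityMeasure ℝ) (f : ℕ → ℕ), StrictMono f ∧ Tendsto (μ ∘ f) atTop (𝓝 ν) := by
  have htight : IsTightMeasureSet {((ρ : ProbabilityMeasure ℝ) : Measure ℝ) | ρ ∈ Set.range μ} := by
    refine isTightMeasureSet_of_tendsto_measure_norm_gt ?_
    have hlim : Tendsto (fun r : ℝ => ENNReal.ofReal (K / r ^ 2)) atTop (𝓝 0) := by
      simpa using ENNReal.tendsto_ofReal
        (tendsto_const_nhds.div_atTop (tendsto_pow_atTop (α := ℝ) two_ne_zero))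
    refine tendsto_of_tendsto_of_tendsto_of_le_of_le' tendsto_const_nhds hlim
      (Eventually.of_forall fun _ => zero_le) ?_
    filter_upwards [eventually_gt_atTop 0] with r hr
    refine iSup₂_le ?_
    rintro _ ⟨_, ⟨N, rfl⟩, rfl⟩
    have hmarkov := ((hμ N).measureReal_le_abs_mul_pow_le hr.le 1).trans (hK N)
    rw [mul_one, ← le_div_iff₀' (by positivity)] at hmarkov
    calc (μ N : Measure ℝ) {x | r < ‖x‖} ≤ (μ N : Measure ℝ) {x | r ≤ |x|} :=
          measure_mono fun x (hx : r < |x|) => hx.le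
      _ = ENNReal.ofReal ((μ N : Measure ℝ).real {x | r ≤ |x|}) := (ofReal_measureReal).symm
      _ ≤ ENNReal.ofReal (K / r ^ 2) := ENNReal.ofReal_le_ofReal hmarkov
  obtain ⟨ν, -, f, hf, hν⟩ := (isCompact_closure_of_isTightMeasureSet htight).tendsto_subseq
    (x := μ) fun N => subset_closure ⟨N, rfl⟩
  exact ⟨ν, f, hf, hν⟩

lemma hasMoments_of_tendsto (hμ : ∀ N, HasMoments (μ N) (m N)) (hν : Tendsto μ atTop (𝓝 ν))
    (hm : ∀ k, Tendsto (fun N => m N k) atTop (𝓝 (a k))) : HasMoments ν a := by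
  intro k
  refine integral_eq_of_tendsto_of_tendsto_sq hν (b := a (k * 2)) (by fun_prop)
    (fun N => (hμ N k).1) (fun N => ?_) ?_ ?_
  · simpa only [← pow_mul] using (hμ N (k * 2)).1
  · simpa only [← pow_mul, fun N => (hμ N (k * 2)).2] using hm (k * 2)
  · simpa only [fun N => (hμ N k).2] using hm k

lemma exists_subseq_tendsto_of_tendsto_moments (hμ : ∀ N, HasMoments (μ N) (m N))
    (hm : ∀ k, Tendsto (fun N => m N k) atTop (𝓝 (a k))) :
    ∃ (ν : ProbabilityMeasure ℝ) (f : ℕ → ℕ), HasMoments ν a ∧ Tendsto (μ ∘ f) atTop (𝓝 ν) := by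
  obtain ⟨K, hK⟩ := (hm 2).bddAbove_range
  obtain ⟨ν, f, hf, hν⟩ := exists_subseq_tendsto_of_hasMoments hμ fun N => hK ⟨N, rfl⟩
  exact ⟨ν, f, hasMoments_of_tendsto (fun N => hμ (f N)) hν
    fun k => (hm k).comp hf.tendsto_atTop, hν⟩

lemma exists_tendsto_of_tendsto_moments (hμ : ∀ N, HasMoments (μ N) (m N))
    (hC : ∀ k, |a k| ≤ C ^ k) (hm : ∀ k, Tendsto (fun N => m N k) atTop (𝓝 (a k))) :
    ∃ ν : ProbabilityMeasure ℝ, HasMoments ν a ∧ Tendsto μ atTop (𝓝 ν) := by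
  obtain ⟨ν, -, hν, -⟩ := exists_subseq_tendsto_of_tendsto_moments hμ hm
  refine ⟨ν, hν, tendsto_of_subseq_tendsto fun ns hns => ?_⟩
  obtain ⟨ν', f, hν', hf⟩ := exists_subseq_tendsto_of_tendsto_moments (fun N => hμ (ns N))
    fun k => (hm k).comp hns
  exact ⟨f, hν'.unique hν hC ▸ hf⟩

end MomentProblem

section LawOfSelfAdjoint

lemma exists_probabilityMeasure_integral_eq {K : Type*} [TopologicalSpace K] [CompactSpace K]
    [T2Space K] [MeasurableSpace K] [BorelSpace K] (Λ : C(K, ℝ) →ₗ[ℝ] ℝ)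
    (hΛ : ∀ g : C(K, ℝ), 0 ≤ g → 0 ≤ Λ g) (h1 : Λ 1 = 1) :
    ∃ ρ : ProbabilityMeasure K, ∀ g : C(K, ℝ), ∫ x, g x ∂(ρ : Measure K) = Λ g := by
  let Λ' : CompactlySupportedContinuousMap K ℝ →ₗ[ℝ] ℝ :=
    { toFun := fun f => Λ f.toContinuousMap
      map_add' := fun f g => Λ.map_add f.toContinuousMap g.toContinuousMap
      map_smul' := fun c f => Λ.map_smul c f.toContinuousMap }
  let ρ := RealRMK.rieszMeasure (PositiveLinearMap.mk₀ Λ' fun f hf => hΛ f.toContinuousMap hf)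
  have hρ : ∀ g : C(K, ℝ), ∫ x, g x ∂ρ = Λ g := fun g =>
    RealRMK.integral_rieszMeasure _ (CompactlySupportedContinuousMap.continuousMapEquiv g)
  have hmass : ρ.real Set.univ = 1 := by simpa [h1] using hρ 1
  exact ⟨⟨ρ, ⟨(ENNReal.toReal_eq_one_iff _).1 hmass⟩⟩, hρ⟩

namespace IsState

lemma ofReal_re {A : Type*} [Ring A] [StarRing A] [Algebra ℂ A] {φ : A →ₗ[ℂ] ℂ}
    (hφ : IsState φ) {b : A} (hb : IsSelfAdjoint b) : ((φ b).re : ℂ) = φ b := by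
  have him (a : A) : (φ (star a * a)).im = 0 := (Complex.le_def.1 (hφ.nonneg a)).2.symm
  have hexpand : star (1 + b) * (1 + b) = 1 + (2 : ℂ) • b + star b * b := by
    rw [star_add, star_one, hb.star_eq, two_smul]
    noncomm_ring
  have him_one_add := him (1 + b)
  rw [hexpand, map_add, map_add, map_smul, hφ.map_one, Complex.add_im, him b] at him_one_add
  exact Complex.ext rfl (Eq.symm (by simpa using him_one_add))

variable {A : Type*} [CStarAlgebra A] {φ : A →ₗ[ℂ] ℂ} {a : A}

lemma exists_integral_eq_re_cfcHom (hφ : IsState φ) (ha : IsSelfAdjoint a) :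
    ∃ ρ : ProbabilityMeasure (spectrum ℝ a), ∀ g : C(spectrum ℝ a, ℝ),
      ∫ x, g x ∂(ρ : Measure (spectrum ℝ a)) = (φ (cfcHom (R := ℝ) ha g)).re := by
  refine exists_probabilityMeasure_integral_eq
    (Complex.reLm ∘ₗ φ.restrictScalars ℝ ∘ₗ (cfcHom (R := ℝ) ha).toAlgHom.toLinearMap) ?_ ?_
  · intro g hg
    let s : C(spectrum ℝ a, ℝ) := ⟨fun x => √(g x), by fun_prop⟩
    have hs : g = star s * s := by
      ext x
      exact (Real.mul_self_sqrt (hg x)).symm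
    change 0 ≤ (φ (cfcHom (R := ℝ) ha g)).re
    rw [hs, map_mul, map_star]
    exact (Complex.le_def.1 (hφ.nonneg _)).1
  · change (φ (cfcHom (R := ℝ) ha 1)).re = 1
    rw [_root_.map_one, hφ.map_one, Complex.one_re]

lemma exists_integral_pow_eq_re_map_pow (hφ : IsState φ) (ha : IsSelfAdjoint a) :
    ∃ ρ : ProbabilityMeasure (spectrum ℝ a), ∀ k : ℕ,
      ∫ x : spectrum ℝ a, (x : ℝ) ^ k ∂(ρ : Measure (spectrum ℝ a)) = (φ (a ^ k)).re := by
  obtain ⟨ρ, hρ⟩ := hφ.exists_integral_eq_re_cfcHom ha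
  refine ⟨ρ, fun k => ?_⟩
  have hpow := hρ (((ContinuousMap.id ℝ).restrict (spectrum ℝ a)) ^ k)
  rw [map_pow, cfcHom_id ha] at hpow
  simpa using hpow

lemma exists_hasMoments (hφ : IsState φ) (ha : IsSelfAdjoint a) :
    ∃ μ : ProbabilityMeasure ℝ, HasMoments μ fun k => (φ (a ^ k)).re := by
  obtain ⟨ρ, hρ⟩ := hφ.exists_integral_pow_eq_re_map_pow ha
  have hint (k : ℕ) :
      Integrable (fun x : spectrum ℝ a => (x : ℝ) ^ k) (ρ : Measure (spectrum ℝ a)) :=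
    Continuous.integrable_of_hasCompactSupport (by fun_prop) (.of_compactSpace _)
  refine ⟨ρ.map (f := Subtype.val) (by fun_prop), fun k => ⟨?_, ?_⟩⟩
  · exact (integrable_map_measure (by fun_prop) (by fun_prop)).2 (hint k)
  · exact (integral_map (by fun_prop) (by fun_prop)).trans (hρ k)

lemma abs_re_map_pow_le (hφ : IsState φ) (ha : IsSelfAdjoint a) (k : ℕ) :
    |(φ (a ^ k)).re| ≤ ‖a‖ ^ k := by
  have : Nontrivial A := nontrivial_of_ne 1 0 fun h => by simpa [h] using hφ.map_one
  obtain ⟨ρ, hρ⟩ := hφ.exists_integral_pow_eq_re_map_pow ha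
  have hle (x : spectrum ℝ a) : ‖(x : ℝ) ^ k‖ ≤ ‖a‖ ^ k := by
    rw [norm_pow]
    exact pow_le_pow_left₀ (norm_nonneg _) (spectrum.norm_le_norm_of_mem x.2) k
  simpa [hρ k] using
    norm_integral_le_of_norm_le_const (μ := (ρ : Measure (spectrum ℝ a))) (.of_forall hle)

end IsState

lemma hasDistribution_iff_hasMoments {A : Type*} [Ring A] [Algebra ℂ A] {φ : A →ₗ[ℂ] ℂ} {a : A}
    {m : ℕ → ℝ} (h : ∀ k, φ (a ^ k) = m k) {μ : ProbabilityMeasure ℝ} :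
    HasDistribution φ a μ ↔ HasMoments μ m := by
  refine forall_congr' fun k => and_congr_right fun _ => ?_
  rw [h k, Complex.ofReal_inj, eq_comm]

lemma IsState.hasDistribution_iff_eq {A : Type*} [CStarAlgebra A] {φ : A →ₗ[ℂ] ℂ} {a : A}
    (hφ : IsState φ) (ha : IsSelfAdjoint a) {μ : ProbabilityMeasure ℝ}
    (hμ : HasMoments μ fun k => (φ (a ^ k)).re) (ρ : ProbabilityMeasure ℝ) :
    HasDistribution φ a ρ ↔ ρ = μ := by
  rw [hasDistribution_iff_hasMoments fun k => (hφ.ofReal_re (ha.pow k)).symm]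
  exact ⟨fun h => h.unique hμ (hφ.abs_re_map_pow_le ha), fun h => h ▸ hμ⟩

end LawOfSelfAdjoint

/-! ### Hilbert space model of monotone independence -/

section MultiplicationOperator

open ContinuousLinearMap (adjoint)
open scoped InnerProductSpace ENNReal

variable {α H : Type*} {mα : MeasurableSpace α} {μ : Measure α} [NormedAddCommGroup H]
  [InnerProductSpace ℂ H]

/-- Pointwise multiplication of square integrable `H`-valued functions by `f`. -/
noncomputable def mulOperator (H : Type*) [NormedAddCommGroup H] [InnerProductSpace ℂ H]
    (f : Lp ℂ ∞ μ) : Lp H 2 μ →L[ℂ] Lp H 2 μ :=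
  (ContinuousLinearMap.lsmul ℂ ℂ).holderL μ ∞ 2 2 f

lemma coeFn_mulOperator (f : Lp ℂ ∞ μ) (g : Lp H 2 μ) :
    mulOperator H f g =ᵐ[μ] fun t => f t • g t :=
  ContinuousLinearMap.coeFn_holder (r := 2) (ContinuousLinearMap.lsmul ℂ ℂ) f g

lemma coeFn_mulOperator_pow_const [IsFiniteMeasure μ] (f : Lp ℂ ∞ μ) (k : ℕ) (v : H) :
    (mulOperator H f ^ k) (Lp.constL 2 μ ℂ v) =ᵐ[μ] fun t => f t ^ k • v := by
  induction k with
  | zero =>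
    filter_upwards [Lp.coeFn_const (p := 2) (μ := μ) v] with t ht
    simpa using ht
  | succ k ih =>
    rw [pow_succ', mul_apply_eq_comp]
    filter_upwards [coeFn_mulOperator f ((mulOperator H f ^ k) (Lp.constL 2 μ ℂ v)), ih]
      with t hmul hk
    rw [hmul, hk, smul_smul, pow_succ']

variable [CompleteSpace H]

lemma isSelfAdjoint_mulOperator {f : Lp ℂ ∞ μ} (hf : ∀ᵐ t ∂μ, IsSelfAdjoint (f t)) :
    IsSelfAdjoint (mulOperator H f) := by
  refine ContinuousLinearMap.isSelfAdjoint_iff_isSymmetric.2 fun g h => ?_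
  change ⟪mulOperator H f g, h⟫_ℂ = ⟪g, mulOperator H f h⟫_ℂ
  rw [L2.inner_def, L2.inner_def]
  refine integral_congr_ae ?_
  filter_upwards [coeFn_mulOperator f g, coeFn_mulOperator f h, hf] with t hg hh hft
  rw [hg, hh, inner_smul_left, inner_smul_right, starRingEnd_apply, hft.star_eq]

lemma adjoint_constL_comp_mulOperator_pow_comp_constL [IsFiniteMeasure μ] (f : Lp ℂ ∞ μ) (k : ℕ) :
    adjoint (Lp.constL 2 μ ℂ : H →L[ℂ] Lp H 2 μ) ∘L (mulOperator H f ^ k) ∘L Lp.constL 2 μ ℂ =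
      (∫ t, f t ^ k ∂μ) • 1 := by
  ext v
  refine ext_inner_left ℂ fun w => ?_
  have hpointwise : ∀ᵐ t ∂μ, ⟪(Lp.constL 2 μ ℂ w : Lp H 2 μ) t,
      ((mulOperator H f ^ k) (Lp.constL 2 μ ℂ v)) t⟫_ℂ = f t ^ k * ⟪w, v⟫_ℂ := by
    filter_upwards [Lp.coeFn_const (p := 2) (μ := μ) w, coeFn_mulOperator_pow_const f k v]
      with t hw hv
    rw [hv, inner_smul_right]
    exact congr(_ * ⟪$hw, v⟫_ℂ)
  rw [ContinuousLinearMap.comp_apply, ContinuousLinearMap.adjoint_inner_right, L2.inner_def]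
  refine (integral_congr_ae hpointwise).trans ?_
  rw [integral_mul_const, smul_apply, inner_smul_right]
  rfl

lemma adjoint_constL_comp_constL [IsProbabilityMeasure μ] :
    adjoint (Lp.constL 2 μ ℂ : H →L[ℂ] Lp H 2 μ) ∘L Lp.constL 2 μ ℂ = 1 := by
  refine (ContinuousLinearMap.norm_map_iff_adjoint_comp_self _).1 fun v => ?_
  rw [Lp.constL_apply, Lp.norm_const' _ _ _ two_ne_zero ENNReal.ofNat_ne_top, probReal_univ,
    Real.one_rpow, mul_one]

end MultiplicationOperator

section MonotoneTower

open ContinuousLinearMap (adjoint)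
open scoped ENNReal

/-- Operators `Y i`, `i < N`, on a Hilbert space with a vacuum vector `Ω` and an increasing family
of projections `E i` that fix `Ω`, such that `Y i` lives on the range of `E (i + 1)` and its powers
are scalar, equal to the moments `m`, when compressed to the range of `E i`. This makes the `Y i`
monotone independent in the vacuum state. -/
structure IsMonotoneTower {H : Type*} [NormedAddCommGroup H] [InnerProductSpace ℂ H]
    [CompleteSpace H] (m : ℕ → ℝ) (N : ℕ) (Ω : H) (E Y : ℕ → H →L[ℂ] H) : Prop where
  norm_vac : ‖Ω‖ = 1
  proj_vac : E 0 Ω = Ω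
  isSelfAdjoint_proj : ∀ i, IsSelfAdjoint (E i)
  proj_mul_proj : ∀ i j, i ≤ j → E i * E j = E i
  proj_top : E N = 1
  isSelfAdjoint_var : ∀ i, IsSelfAdjoint (Y i)
  var_mul_proj_succ : ∀ i < N, Y i * E (i + 1) = Y i
  proj_mul_var_pow_mul_proj : ∀ i < N, ∀ k : ℕ, E i * Y i ^ k * E i = (m k : ℂ) • E i

lemma isMonotoneTower_zero (m : ℕ → ℝ) :
    IsMonotoneTower m 0 (1 : ℂ) (fun _ => 1) (fun _ => 0) where
  norm_vac := norm_one
  proj_vac := rfl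
  isSelfAdjoint_proj _ := .one _
  proj_mul_proj _ _ _ := one_mul _
  proj_top := rfl
  isSelfAdjoint_var _ := .zero _
  var_mul_proj_succ _ h := absurd h (Nat.not_lt_zero _)
  proj_mul_var_pow_mul_proj _ h := absurd h (Nat.not_lt_zero _)

section Isometry

variable {H H' : Type*} [NormedAddCommGroup H] [InnerProductSpace ℂ H] [CompleteSpace H]
  [NormedAddCommGroup H'] [InnerProductSpace ℂ H'] [CompleteSpace H']

/-- The (in general non-unital) embedding `T ↦ J T J*` of operators induced by `J`. -/
noncomputable def conjBy (J : H →L[ℂ] H') (T : H →L[ℂ] H) : H' →L[ℂ] H' :=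
  J ∘L T ∘L adjoint J

variable {J : H →L[ℂ] H'}

lemma conjBy_smul (c : ℂ) (T : H →L[ℂ] H) : conjBy J (c • T) = c • conjBy J T := by
  ext v
  simp [conjBy]

lemma isSelfAdjoint_conjBy {T : H →L[ℂ] H} (hT : IsSelfAdjoint T) : IsSelfAdjoint (conjBy J T) :=
  hT.conj_adjoint J

lemma conjBy_mul_conjBy (hJ : adjoint J ∘L J = 1) (S T : H →L[ℂ] H) :
    conjBy J S * conjBy J T = conjBy J (S * T) := by
  ext v
  exact congr(J (S ($hJ (T (adjoint J v)))))

lemma conjBy_mul_conjBy_pow (hJ : adjoint J ∘L J = 1) (S T : H →L[ℂ] H) (k : ℕ) :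
    conjBy J S * conjBy J T ^ k = conjBy J (S * T ^ k) := by
  induction k with
  | zero => rw [pow_zero, pow_zero, mul_one, mul_one]
  | succ k ih => rw [pow_succ, ← mul_assoc, ih, conjBy_mul_conjBy hJ, pow_succ, mul_assoc]

lemma conjBy_one_mul_mul_conjBy_one {x : H' →L[ℂ] H'} {c : ℂ}
    (hx : adjoint J ∘L x ∘L J = c • 1) : conjBy J 1 * x * conjBy J 1 = c • conjBy J 1 := by
  ext v
  exact congr(J ($hx (adjoint J v))).trans (J.map_smul _ _)

lemma IsMonotoneTower.succ {m : ℕ → ℝ} {N : ℕ} {Ω : H} {E Y : ℕ → H →L[ℂ] H}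
    (h : IsMonotoneTower m N Ω E Y) (hJ : adjoint J ∘L J = 1)
    {x : H' →L[ℂ] H'} (hx : IsSelfAdjoint x)
    (hxk : ∀ k : ℕ, adjoint J ∘L (x ^ k) ∘L J = (m k : ℂ) • 1) :
    IsMonotoneTower m (N + 1) (J Ω) (fun i => if i ≤ N then conjBy J (E i) else 1)
      (fun i => if i < N then conjBy J (Y i) else x) where
  norm_vac := (J.norm_map_iff_adjoint_comp_self.2 hJ Ω).trans h.norm_vac
  proj_vac := by
    have hΩ : adjoint J (J Ω) = Ω := congr($hJ Ω)
    simp [conjBy, hΩ, h.proj_vac]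
  isSelfAdjoint_proj i := by
    split_ifs
    exacts [isSelfAdjoint_conjBy (h.isSelfAdjoint_proj i), .one _]
  proj_mul_proj i j hij := by
    by_cases hj : j ≤ N
    · simp only [if_pos hj, if_pos (hij.trans hj), conjBy_mul_conjBy hJ, h.proj_mul_proj i j hij]
    · simp only [if_neg hj, mul_one]
  proj_top := by simp
  isSelfAdjoint_var i := by
    split_ifs
    exacts [isSelfAdjoint_conjBy (h.isSelfAdjoint_var i), hx]
  var_mul_proj_succ i _ := by
    by_cases hiN : i < N
    · simp only [if_pos hiN, if_pos (Nat.succ_le_of_lt hiN), conjBy_mul_conjBy hJ,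
        h.var_mul_proj_succ i hiN]
    · simp only [if_neg hiN, if_neg (mt Nat.lt_of_succ_le hiN), mul_one]
  proj_mul_var_pow_mul_proj i hi k := by
    rcases (Nat.le_of_lt_succ hi).lt_or_eq with hiN | rfl
    · simp only [if_pos hiN, if_pos hiN.le, conjBy_mul_conjBy_pow hJ, conjBy_mul_conjBy hJ,
        h.proj_mul_var_pow_mul_proj i hiN k, conjBy_smul]
    · simp only [lt_irrefl, if_false, le_refl, if_true, h.proj_top,
        conjBy_one_mul_mul_conjBy_one (hxk k)]

end Isometry

lemma exists_isMonotoneTower {ν : ProbabilityMeasure ℝ} {m : ℕ → ℝ} (h : HasMoments ν m) {R : ℝ}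
    (hR : ∀ᵐ x ∂(ν : Measure ℝ), |x| ≤ R) (N : ℕ) :
    ∃ (H : Type) (_ : NormedAddCommGroup H) (_ : InnerProductSpace ℂ H) (_ : CompleteSpace H)
      (Ω : H) (E Y : ℕ → H →L[ℂ] H), IsMonotoneTower m N Ω E Y := by
  have hbdd : MemLp (fun t : ℝ => (t : ℂ)) ∞ (ν : Measure ℝ) :=
    memLp_top_of_bound (by fun_prop) R (by simpa using hR)
  let f : Lp ℂ ∞ (ν : Measure ℝ) := hbdd.toLp
  have hsa : ∀ᵐ t ∂(ν : Measure ℝ), IsSelfAdjoint (f t) := by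
    filter_upwards [hbdd.coeFn_toLp] with t ht
    exact ht ▸ Complex.conj_ofReal t
  have hmom (k : ℕ) : ∫ t, f t ^ k ∂(ν : Measure ℝ) = m k := by
    rw [← (h k).2, ← integral_complex_ofReal]
    refine integral_congr_ae ?_
    filter_upwards [hbdd.coeFn_toLp] with t ht
    rw [ht, Complex.ofReal_pow]
  induction N with
  | zero => exact ⟨ℂ, inferInstance, inferInstance, inferInstance, _, _, _, isMonotoneTower_zero m⟩
  | succ N ih =>
    obtain ⟨H, _, _, _, Ω, E, Y, hT⟩ := ih
    have hcomp (k : ℕ) := hmom k ▸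
      adjoint_constL_comp_mulOperator_pow_comp_constL (H := H) f k
    exact ⟨Lp H 2 (ν : Measure ℝ), inferInstance, inferInstance, inferInstance, _, _, _,
      hT.succ adjoint_constL_comp_constL (isSelfAdjoint_mulOperator hsa) hcomp⟩

end MonotoneTower

section TowerState

open scoped InnerProductSpace

lemma mem_span_pow_succ_of_mem_adjoin {R A : Type*} [CommSemiring R] [StarRing R] [Semiring A]
    [StarRing A] [Algebra R A] [StarModule R A] {y a : A} (hy : IsSelfAdjoint y)
    (ha : a ∈ NonUnitalStarAlgebra.adjoin R {y}) :
    a ∈ Submodule.span R (Set.range fun k : ℕ => y ^ (k + 1)) := by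
  induction ha using NonUnitalStarAlgebra.adjoin_induction with
  | mem x hx => exact Submodule.subset_span ⟨0, (pow_one y).trans hx.symm⟩
  | add x z _ _ hx hz => exact add_mem hx hz
  | zero => exact zero_mem _
  | mul x z _ _ hx hz =>
    have hxz := Submodule.mul_mem_mul hx hz
    rw [Submodule.span_mul_span] at hxz
    refine Submodule.span_mono ?_ hxz
    rintro _ ⟨_, ⟨p, rfl⟩, _, ⟨q, rfl⟩, rfl⟩
    exact ⟨p + 1 + q, by simp only [← pow_add, add_assoc]⟩
  | smul c x _ hx => exact Submodule.smul_mem _ c hx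
  | star x hmem hx =>
    clear hmem
    induction hx using Submodule.span_induction with
    | mem x hx =>
      obtain ⟨p, rfl⟩ := hx
      exact Submodule.subset_span ⟨p, by rw [star_pow, hy.star_eq]⟩
    | zero => rw [star_zero]; exact zero_mem _
    | add x z _ _ hx hz => rw [star_add]; exact add_mem hx hz
    | smul c x _ hx => rw [star_smul]; exact Submodule.smul_mem _ _ hx

variable {H : Type*} [NormedAddCommGroup H] [InnerProductSpace ℂ H]

/-- The vector functional `T ↦ ⟪Ω, T Ω⟫`. -/
noncomputable def vectorState (Ω : H) : (H →L[ℂ] H) →ₗ[ℂ] ℂ where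
  toFun T := ⟪Ω, T Ω⟫_ℂ
  map_add' S T := by rw [add_apply, inner_add_right]
  map_smul' c T := by rw [smul_apply, inner_smul_right]; rfl

lemma vectorState_apply (Ω : H) (T : H →L[ℂ] H) : vectorState Ω T = ⟪Ω, T Ω⟫_ℂ := rfl

variable [CompleteSpace H] {m : ℕ → ℝ} {N : ℕ} {Ω : H} {E Y : ℕ → H →L[ℂ] H}

lemma isState_vectorState (hΩ : ‖Ω‖ = 1) : IsState (vectorState Ω) where
  nonneg T := by
    rw [vectorState_apply, mul_apply_eq_comp, ContinuousLinearMap.star_eq_adjoint,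
      ContinuousLinearMap.adjoint_inner_right, inner_self_eq_norm_sq_to_K]
    rw [← RCLike.ofReal_pow]
    exact Complex.zero_le_real.2 (sq_nonneg ‖T Ω‖)
  map_one := by
    rw [vectorState_apply, one_apply_eq_self, inner_self_eq_norm_sq_to_K, hΩ, RCLike.ofReal_one,
      one_pow]

namespace IsMonotoneTower

lemma proj_mul_proj' (h : IsMonotoneTower m N Ω E Y) {i j : ℕ} (hij : i ≤ j) :
    E j * E i = E i := by
  have hstar := congr(star $(h.proj_mul_proj i j hij))
  rwa [star_mul, (h.isSelfAdjoint_proj i).star_eq, (h.isSelfAdjoint_proj j).star_eq] at hstar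

lemma proj_apply_vac (h : IsMonotoneTower m N Ω E Y) (i : ℕ) : E i Ω = Ω := by
  have hvac := congr($(h.proj_mul_proj' (Nat.zero_le i)) Ω)
  rwa [mul_apply_eq_comp, h.proj_vac] at hvac

lemma vectorState_mul_proj (h : IsMonotoneTower m N Ω E Y) (i : ℕ) (T : H →L[ℂ] H) :
    vectorState Ω (T * E i) = vectorState Ω T := by
  rw [vectorState_apply, mul_apply_eq_comp, h.proj_apply_vac, vectorState_apply]

lemma vectorState_proj_mul (h : IsMonotoneTower m N Ω E Y) (i : ℕ) (T : H →L[ℂ] H) :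
    vectorState Ω (E i * T) = vectorState Ω T := by
  rw [vectorState_apply, mul_apply_eq_comp, ← ContinuousLinearMap.adjoint_inner_left,
    ← ContinuousLinearMap.star_eq_adjoint, (h.isSelfAdjoint_proj i).star_eq, h.proj_apply_vac,
    vectorState_apply]

lemma vectorState_var_pow (h : IsMonotoneTower m N Ω E Y) {i : ℕ} (hi : i < N) (k : ℕ) :
    vectorState Ω (Y i ^ k) = m k := by
  have hproj : vectorState Ω (E i) = 1 := by
    rw [← one_mul (E i), h.vectorState_mul_proj, (isState_vectorState h.norm_vac).map_one]
  rw [← h.vectorState_proj_mul i, ← h.vectorState_mul_proj i, h.proj_mul_var_pow_mul_proj i hi k,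
    map_smul, hproj, smul_eq_mul, mul_one]

lemma proj_mul_mul_proj (h : IsMonotoneTower m N Ω E Y) {i : ℕ} (hi : i < N) {a : H →L[ℂ] H}
    (ha : a ∈ NonUnitalStarAlgebra.adjoin ℂ {Y i}) : E i * a * E i = vectorState Ω a • E i := by
  replace ha := mem_span_pow_succ_of_mem_adjoin (h.isSelfAdjoint_var i) ha
  induction ha using Submodule.span_induction with
  | mem x hx =>
    obtain ⟨p, rfl⟩ := hx
    rw [h.vectorState_var_pow hi, h.proj_mul_var_pow_mul_proj i hi]
  | zero => rw [mul_zero, zero_mul, map_zero, zero_smul]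
  | add x z _ _ hx hz => rw [mul_add, add_mul, hx, hz, map_add, add_smul]
  | smul c x _ hx => rw [mul_smul_comm, smul_mul_assoc, hx, map_smul, smul_assoc]

lemma mul_proj_of_mem (h : IsMonotoneTower m N Ω E Y) {i j : ℕ} (hi : i < N) (hij : i < j)
    {a : H →L[ℂ] H} (ha : a ∈ NonUnitalStarAlgebra.adjoin ℂ {Y i}) : a * E j = a := by
  have hvar : Y i * E j = Y i := by
    rw [← h.var_mul_proj_succ i hi, mul_assoc, h.proj_mul_proj _ _ hij]
  replace ha := mem_span_pow_succ_of_mem_adjoin (h.isSelfAdjoint_var i) ha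
  induction ha using Submodule.span_induction with
  | mem x hx =>
    obtain ⟨p, rfl⟩ := hx
    simp only [pow_succ, mul_assoc, hvar]
  | zero => rw [zero_mul]
  | add x z _ _ hx hz => rw [add_mul, hx, hz]
  | smul c x _ hx => rw [smul_mul_assoc, hx]

lemma proj_mul_of_mem (h : IsMonotoneTower m N Ω E Y) {i j : ℕ} (hi : i < N) (hij : i < j)
    {a : H →L[ℂ] H} (ha : a ∈ NonUnitalStarAlgebra.adjoin ℂ {Y i}) : E j * a = a := by
  have hstar := congr(star $(h.mul_proj_of_mem hi hij (star_mem ha)))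
  rwa [star_mul, star_star, (h.isSelfAdjoint_proj j).star_eq] at hstar

variable {i : Fin N} {w : List (Fin N × (H →L[ℂ] H))}

lemma vectorState_word_mul_proj_mul (h : IsMonotoneTower m N Ω E Y)
    (hw : ∀ p ∈ w, p.2 ∈ NonUnitalStarAlgebra.adjoin ℂ {Y p.1}) (hlt : ∀ p ∈ w.getLast?, p.1 < i)
    (T : H →L[ℂ] H) :
    vectorState Ω ((w.map Prod.snd).prod * (E i * T)) =
      vectorState Ω ((w.map Prod.snd).prod * T) := by
  rcases List.eq_nil_or_concat' w with rfl | ⟨w', p, rfl⟩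
  · simp only [List.map_nil, List.prod_nil, one_mul, h.vectorState_proj_mul]
  · have hproj := h.mul_proj_of_mem p.1.2 (hlt p (by simp)) (hw p (by simp))
    rw [← mul_assoc, List.map_append, List.prod_append, List.map_singleton, List.prod_singleton,
      mul_assoc _ p.2, hproj]

lemma vectorState_mul_proj_mul_word (h : IsMonotoneTower m N Ω E Y)
    (hw : ∀ p ∈ w, p.2 ∈ NonUnitalStarAlgebra.adjoin ℂ {Y p.1}) (hlt : ∀ p ∈ w.head?, p.1 < i)
    (T : H →L[ℂ] H) :
    vectorState Ω (T * E i * (w.map Prod.snd).prod) =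
      vectorState Ω (T * (w.map Prod.snd).prod) := by
  rcases w with _ | ⟨p, w'⟩
  · simp only [List.map_nil, List.prod_nil, mul_one, h.vectorState_mul_proj]
  · have hproj := h.proj_mul_of_mem p.1.2 (hlt p (by simp)) (hw p (by simp))
    rw [mul_assoc, List.map_cons, List.prod_cons, ← mul_assoc (E i), hproj]

lemma monotoneIndep (h : IsMonotoneTower m N Ω E Y) :
    MonotoneIndep (vectorState Ω) fun i : Fin N => Y i := by
  intro u v i a hw _ hu hv
  have hmem : ∀ p ∈ u ++ (i, a) :: v, p.2 ∈ NonUnitalStarAlgebra.adjoin ℂ {Y p.1} :=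
    fun p hp => (hw p hp).1
  simp only [List.mem_append, List.mem_cons] at hmem
  have hmemu : ∀ p ∈ u, p.2 ∈ NonUnitalStarAlgebra.adjoin ℂ {Y p.1} :=
    fun p hp => hmem p (.inl hp)
  have hmemv : ∀ p ∈ v, p.2 ∈ NonUnitalStarAlgebra.adjoin ℂ {Y p.1} :=
    fun p hp => hmem p (.inr (.inr hp))
  have ha := h.proj_mul_mul_proj i.2 (hmem (i, a) (.inr (.inl rfl)))
  simp only [List.map_append, List.map_cons, List.prod_append, List.prod_cons]
  generalize hU : (u.map Prod.snd).prod = U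
  generalize hV : (v.map Prod.snd).prod = V
  calc vectorState Ω (U * (a * V))
      = vectorState Ω (U * (E i * (a * V))) := by
        rw [← hU, h.vectorState_word_mul_proj_mul hmemu hu]
    _ = vectorState Ω (U * E i * a * V) := by simp only [mul_assoc]
    _ = vectorState Ω (U * E i * a * E i * V) := by
        rw [← hV, h.vectorState_mul_proj_mul_word hmemv hv]
    _ = vectorState Ω (U * (E i * a * E i) * V) := by simp only [mul_assoc]
    _ = vectorState Ω a * vectorState Ω (U * E i * V) := by
        rw [ha, mul_smul_comm, smul_mul_assoc, map_smul, smul_eq_mul]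
    _ = vectorState Ω a * vectorState Ω (U * V) := by
        rw [← hV, h.vectorState_mul_proj_mul_word hmemv hv]

end IsMonotoneTower

end TowerState

/-! ### The law with given cumulants and the limit theorem -/

section MonotoneLimit

open PowerSeries

lemma MonotoneIndep.map_sum_pow_eq_coeff {A ι : Type*} [Ring A] [StarRing A] [Algebra ℂ A]
    [StarModule ℂ A] [LinearOrder ι] {φ : A →ₗ[ℂ] ℂ} {x : ι → A} (hind : MonotoneIndep φ x)
    (h1 : φ 1 = 1) {M : ℝ⟦X⟧} (hM : ∀ i k, φ (x i ^ k) = (coeff k M : ℝ))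
    (hvar : coeff 2 M ≠ coeff 1 M ^ 2) (s : Finset ι) (n : ℕ) :
    φ ((∑ i ∈ s, x i) ^ n) = (coeff n (monotonePow M s.card) : ℝ) := by
  have hM' (i : ι) : momentSeries φ (x i) = PowerSeries.map (algebraMap ℝ ℂ) M := by
    ext k
    rw [coeff_momentSeries, hM, coeff_map, Complex.coe_algebraMap]
  have hvar' : coeff 2 (PowerSeries.map (algebraMap ℝ ℂ) M) ≠
      coeff 1 (PowerSeries.map (algebraMap ℝ ℂ) M) ^ 2 := by
    rw [coeff_map, coeff_map, ← map_pow]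
    exact (algebraMap ℝ ℂ).injective.ne hvar
  rw [← coeff_momentSeries, hind.momentSeries_sum h1 hM' hvar', ← map_monotonePow, coeff_map,
    Complex.coe_algebraMap]

variable {r : ℕ → ℝ} {C : ℝ}

lemma coeff_two_cumulantMomentSeries (r : ℕ → ℝ) :
    coeff 2 (cumulantMomentSeries r) = r 2 + coeff 1 (cumulantMomentSeries r) ^ 2 := by
  have h1 : coeff 1 (cumulantMomentSeries r) = r 1 := by
    simp [coeff_cumulantMomentSeries, cumulantGenerator, Finset.sum_range_succ]
  have hsq : 2⁻¹ * (r 1 * ((1 + 1) * r 1)) = r 1 ^ 2 := by ring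
  rw [h1, ← hsq]
  simp [coeff_cumulantMomentSeries, cumulantGenerator, Finset.sum_range_succ, pow_two,
    Matrix.mul_apply, Fin.sum_univ_three, Fin.last]

lemma hasMonotoneCumulants_of_hasMoments (hr : r 2 ≠ 0) (hC : ∀ k, 1 ≤ k → |r k| ≤ C ^ k)
    {ν : ProbabilityMeasure ℝ} (h : HasMoments ν fun k => coeff k (cumulantMomentSeries r)) :
    HasMonotoneCumulants ν r := by
  refine ⟨cumulantMomentPolynomial r, fun n hn => coeff_one_cumulantMomentPolynomial r hn,
    fun N => ?_⟩
  obtain ⟨H, _, _, _, Ω, E, Y, hT⟩ :=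
    exists_isMonotoneTower h (h.ae_abs_le (abs_coeff_cumulantMomentSeries_le hC)) N
  have hstate := isState_vectorState hT.norm_vac
  refine ⟨H →L[ℂ] H, inferInstance, inferInstance, inferInstance, inferInstance, vectorState Ω,
    fun i => Y i, hstate, fun i => hT.isSelfAdjoint_var i,
    fun i => (hasDistribution_iff_hasMoments (hT.vectorState_var_pow i.2)).2 h,
    hT.monotoneIndep, fun n _ => ?_⟩
  have hvar : coeff 2 (cumulantMomentSeries r) ≠ coeff 1 (cumulantMomentSeries r) ^ 2 := by
    simpa only [coeff_two_cumulantMomentSeries, ne_eq, add_eq_right] using hr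
  rw [hT.monotoneIndep.map_sum_pow_eq_coeff hstate.map_one
    (fun i k => hT.vectorState_var_pow i.2 k) hvar, Finset.card_univ, Fintype.card_fin,
    eval_cumulantMomentPolynomial]

namespace HasMonotoneCumulants

variable {μ : ProbabilityMeasure ℝ} {m : ℕ → ℝ}

lemma exists_hasMoments (h : HasMonotoneCumulants μ r) : ∃ m, HasMoments μ m := by
  obtain ⟨_, -, hB⟩ := h
  obtain ⟨B, _, _, _, _, ψ, Y, -, -, hd, -⟩ := hB 1
  exact ⟨fun k => ∫ x : ℝ, x ^ k ∂(μ : Measure ℝ), fun k => ⟨(hd 0 k).1, rfl⟩⟩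

/-- For a degenerate law the second moment of the sum is a multiple of `N ^ 2`, so that the second
cumulant vanishes. -/
lemma moment_two_ne_sq (h : HasMonotoneCumulants μ r) (hr : r 2 ≠ 0) (hm : HasMoments μ m) :
    m 2 ≠ m 1 ^ 2 := by
  intro hdeg
  obtain ⟨p, hp1, hB⟩ := h
  have hp2 : p 2 = Polynomial.C (m 1 ^ 2) * Polynomial.X ^ 2 := by
    refine polynomial_ext_natCast fun N => ?_
    obtain ⟨B, _, _, _, _, ψ, Y, hψ, -, hd, hind, hN⟩ := hB N
    have hmom (i : Fin N) (k : ℕ) : ψ (Y i ^ k) = m k := by rw [(hd i k).2, (hm k).2]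
    have hsum := hind.map_sum_sq hψ.map_one (m := m 1) (fun i => by simpa using hmom i 1)
      (fun i => by rw [hmom, hdeg, Complex.ofReal_pow]) Finset.univ
    rw [hN 2 one_le_two, Finset.card_univ, Fintype.card_fin] at hsum
    rw [Polynomial.eval_C_mul, Polynomial.eval_X_pow, mul_comm]
    exact_mod_cast hsum
  refine hr ((hp1 2 one_le_two).symm.trans ?_)
  rw [hp2, Polynomial.coeff_C_mul_X_pow, if_neg (by norm_num)]

lemma hasMoments (h : HasMonotoneCumulants μ r) (hr : r 2 ≠ 0) :
    HasMoments μ fun k => coeff k (cumulantMomentSeries r) := by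
  obtain ⟨m, hm⟩ := h.exists_hasMoments
  have hvar := h.moment_two_ne_sq hr hm
  obtain ⟨p, hp1, hB⟩ := h
  have hm0 : m 0 = 1 := by simpa using (hm 0).2.symm
  have hp (n : ℕ) (hn : 1 ≤ n) (N : ℕ) :
      coeff n (monotonePow (PowerSeries.mk m) N) = (p n).eval (N : ℝ) := by
    obtain ⟨B, _, _, _, _, ψ, Y, hψ, -, hd, hind, hN⟩ := hB N
    have hsum := hind.map_sum_pow_eq_coeff hψ.map_one (M := PowerSeries.mk m)
      (fun i k => by rw [(hd i k).2, (hm k).2, coeff_mk]) (by simpa only [coeff_mk] using hvar)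
      Finset.univ n
    rw [hN n hn, Finset.card_univ, Fintype.card_fin] at hsum
    exact (Complex.ofReal_injective hsum).symm
  rw [← eq_cumulantMomentSeries_of_coeff_one (by
    rw [← coeff_zero_eq_constantCoeff_apply, coeff_mk, hm0]) hp hp1]
  simpa only [coeff_mk] using hm

end HasMonotoneCumulants

lemma eventually_ne_sq_of_tendsto_natCast_mul {a b : ℕ → ℝ} {s t : ℝ} (ht : t ≠ 0)
    (ha : Tendsto (fun N : ℕ => (N : ℝ) * a N) atTop (𝓝 s))
    (hb : Tendsto (fun N : ℕ => (N : ℝ) * b N) atTop (𝓝 t)) : ∀ᶠ N in atTop, b N ≠ a N ^ 2 := by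
  have hsq : Tendsto (fun N : ℕ => (N : ℝ) * a N ^ 2) atTop (𝓝 0) := by
    have hmul := (ha.mul ha).mul (tendsto_inv_atTop_nhds_zero_nat (𝕜 := ℝ))
    rw [mul_zero] at hmul
    refine hmul.congr' ?_
    filter_upwards [eventually_ne_atTop 0] with N hN
    field_simp
  filter_upwards [(hb.sub hsq).eventually_ne (by rwa [sub_zero])] with N hN hbN
  exact hN (by rw [hbN, sub_self])

lemma tendsto_re_map_rowSum_pow {A : Type*} [Ring A] [StarRing A] [Algebra ℂ A] [StarModule ℂ A]
    {φ : A →ₗ[ℂ] ℂ} (hφ : IsState φ) {X : ℕ → ℕ → A} (hr : r 2 ≠ 0)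
    (hsa : ∀ N, ∀ n ∈ Finset.Icc 1 N, IsSelfAdjoint (X N n))
    (hid : ∀ N, ∀ n ∈ Finset.Icc 1 N, ∀ k : ℕ, φ (X N n ^ k) = φ (X N 1 ^ k))
    (hind : ∀ N, MonotoneIndep φ (fun n : Set.Icc 1 N => X N n))
    (hlim : ∀ k : ℕ, 1 ≤ k →
      Tendsto (fun N : ℕ => (N : ℂ) * φ (X N 1 ^ k)) atTop (𝓝 (r k : ℂ))) (k : ℕ) :
    Tendsto (fun N => (φ ((∑ n ∈ Finset.Icc 1 N, X N n) ^ k)).re) atTop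
      (𝓝 (coeff k (cumulantMomentSeries r))) := by
  let M : ℕ → ℝ⟦X⟧ := fun N => PowerSeries.mk fun k => (φ (X N 1 ^ k)).re
  have hM0 (N : ℕ) : constantCoeff (M N) = 1 := by
    rw [← coeff_zero_eq_constantCoeff_apply, coeff_mk, pow_zero, hφ.map_one, Complex.one_re]
  have hMlim (k : ℕ) (hk : 1 ≤ k) :
      Tendsto (fun N : ℕ => (N : ℝ) * coeff k (M N)) atTop (𝓝 (r k)) := by
    simpa [M, Function.comp_def] using (Complex.continuous_re.tendsto _).comp (hlim k hk)
  refine (tendsto_coeff_monotonePow (.of_forall hM0) hMlim k).congr' ?_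
  filter_upwards [eventually_ne_sq_of_tendsto_natCast_mul hr (hMlim 1 le_rfl)
    (hMlim 2 one_le_two), eventually_ge_atTop 1] with N hvar hN
  have hmom (i : Set.Icc 1 N) (k : ℕ) : φ (X N i ^ k) = (coeff k (M N) : ℝ) := by
    rw [hid N i (Finset.mem_Icc.2 i.2), coeff_mk,
      hφ.ofReal_re ((hsa N 1 (Finset.left_mem_Icc.2 hN)).pow k)]
  have hsum : ∑ i : Set.Icc 1 N, X N i = ∑ n ∈ Finset.Icc 1 N, X N n :=
    (Finset.sum_subtype (Finset.Icc 1 N) (fun _ => Finset.mem_Icc) fun n => X N n).symm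
  have hcard : (Finset.univ : Finset (Set.Icc 1 N)).card = N := by simp
  rw [← hsum, (hind N).map_sum_pow_eq_coeff hφ.map_one hmom hvar Finset.univ k, hcard,
    Complex.ofReal_re]

end MonotoneLimit

theorem mainTheorem5_general {A : Type*} [CStarAlgebra A] (φ : A →ₗ[ℂ] ℂ) (hφ : IsState φ)
    (X : ℕ → ℕ → A) (r : ℕ → ℝ) (hr : r 2 ≠ 0) (C : ℝ) (hC : ∀ k, 1 ≤ k → |r k| ≤ C ^ k)
    (hsa : ∀ N, ∀ n ∈ Finset.Icc 1 N, IsSelfAdjoint (X N n))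
    (hid : ∀ N, ∀ n ∈ Finset.Icc 1 N, ∀ k : ℕ, φ (X N n ^ k) = φ (X N 1 ^ k))
    (hind : ∀ N, MonotoneIndep φ (fun n : Set.Icc 1 N => X N n))
    (hlim : ∀ k : ℕ, 1 ≤ k →
      Tendsto (fun N : ℕ => (N : ℂ) * φ (X N 1 ^ k)) atTop (𝓝 (r k : ℂ))) :
    ∃ (μ : ℕ → ProbabilityMeasure ℝ) (ν : ProbabilityMeasure ℝ),
      (∀ N (ρ : ProbabilityMeasure ℝ),
        HasDistribution φ (∑ n ∈ Finset.Icc 1 N, X N n) ρ ↔ ρ = μ N) ∧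
      (∀ ρ : ProbabilityMeasure ℝ, HasMonotoneCumulants ρ r ↔ ρ = ν) ∧
      Tendsto μ atTop (𝓝 ν) := by
  have hS (N : ℕ) : IsSelfAdjoint (∑ n ∈ Finset.Icc 1 N, X N n) := isSelfAdjoint_sum _ (hsa N)
  choose μ hμ using fun N => hφ.exists_hasMoments (hS N)
  have hbound := abs_coeff_cumulantMomentSeries_le hC
  obtain ⟨ν, hν, hconv⟩ := exists_tendsto_of_tendsto_moments hμ hbound
    (tendsto_re_map_rowSum_pow hφ hr hsa hid hind hlim)
  refine ⟨μ, ν, fun N => hφ.hasDistribution_iff_eq (hS N) (hμ N), fun ρ => ⟨fun h => ?_, ?_⟩, hconv⟩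
  · exact (h.hasMoments hr).unique hν hbound
  · rintro rfl
    exact hasMonotoneCumulants_of_hasMoments hr hC hν

/-- The distributions of the row sums exist and are unique, the monotone Poisson distribution exists
and is unique, and the former converge weakly to the latter. Row `N` of the array is
`X N 1, …, X N N`. -/
theorem mainTheorem5 {A : Type*} [CStarAlgebra A] (φ : A →ₗ[ℂ] ℂ) (hφ : IsState φ)
    (X : ℕ → ℕ → A) (l : ℝ) (hl : 0 < l)
    (hsa : ∀ N, ∀ n ∈ Finset.Icc 1 N, IsSelfAdjoint (X N n))
    (hid : ∀ N, ∀ n ∈ Finset.Icc 1 N, ∀ k : ℕ, φ (X N n ^ k) = φ (X N 1 ^ k))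
    (hind : ∀ N, MonotoneIndep φ (fun n : Set.Icc 1 N => X N n))
    (hlim : ∀ k : ℕ, 1 ≤ k →
      Tendsto (fun N : ℕ => (N : ℂ) * φ (X N 1 ^ k)) atTop (𝓝 (l : ℂ))) :
    ∃ (μ : ℕ → ProbabilityMeasure ℝ) (ν : ProbabilityMeasure ℝ),
      (∀ N (ρ : ProbabilityMeasure ℝ),
        HasDistribution φ (∑ n ∈ Finset.Icc 1 N, X N n) ρ ↔ ρ = μ N) ∧
      (∀ ρ : ProbabilityMeasure ℝ, IsMonotonePoisson l ρ ↔ ρ = ν) ∧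
      Tendsto μ atTop (𝓝 ν) :=
  mainTheorem5_general φ hφ X (fun _ => l) hl.ne' (l + 1) (fun k hk => by
    rw [abs_of_pos hl]
    exact (le_add_of_nonneg_right zero_le_one).trans
      (le_self_pow₀ (le_add_of_nonneg_left hl.le) (Nat.one_le_iff_ne_zero.1 hk))) hsa hid hind hlim
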